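/- Let $n\ge 1$, $L=\{1,\dots,n\}$, and let $\mathcal H=\bigotimes_{a\in L}\mathcal H_a$ with $\mathcal H_a=\mathbb C^{d_a}$, $1<d_a<\infty$. For $K\subseteq L$ put $\mathcal H_K=\bigotimes_{a\in K}\mathcal H_a$. A pure state on a finite-dimensional Hilbert space is a self-adjoint projector of trace one; $\mathcal P$ and $\mathcal P_K$ denote the sets of pure states on $\mathcal H$ and $\mathcal H_K$, $\pi_K=\operatorname{tr}_{L\setminus K}\pi$ is the partial trace of $\pi$ over the complement of $K$, and $S(\varrho)=-\operatorname{tr}(\varrho\ln\varrho)$ is the von Neumann entropy (with $0\ln 0=0$). Partitions $\alpha$ of $L$ into nonempty parts are ordered by refinement: $\beta\preceq\alpha$ iff every part of $\beta$ is contained in a part of $\alpha$. Nonempty down-sets $\vec\alpha$ of partitions are ordered by inclusion: $\vec\beta\preceq\vec\alpha$ iff $\vec\beta\subseteq\vec\alpha$. The $\alpha$-separable pure states are $\mathcal P_\alpha=\{\bigotimes_{K\in\alpha}\pi_K : \pi_K\in\mathcal P_K\}$ (here the $\pi_K$ are arbitrary pure states of the parts), and the $\vec\alpha$-separable ones are $\mathcal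 P_{\vec\alpha}=\bigcup_{\alpha\in\vec\alpha}\mathcal P_\alpha$. For $\pi\in\mathcal P$ define $$E_\alpha(\pi)=\frac12\sum_{K\in\alpha}S(\pi_K),\qquad E_{\vec\alpha}(\pi)=\min_{\alpha\in\vec\alpha}E_\alpha(\pi).$$ A pure LOCC protocol consists of finitely many rounds. In each round one party $a$ performs a measurement on its elementary subsystem with finitely many outcomes $i$, with one Kraus operator $M_i:\mathbb C^{d_a}\to\mathbb C^{d_{a,i}'}$ per outcome and $\sum_i M_i^\dagger M_i=\mathbb 1$, and the continuation of the protocol may depend on $i$. The dimension of the measured subsystem may change, all branches ending in the same output space $\bigotimes_a\mathbb C^{e_a}$ (in particular, it may be $\mathcal H$). With $B_j$ the product of the operators applied along the branch $j$ of the protocol, it yields on $\pi$ the ensemble $\{(p_j,\pi_j')\}$, $p_j=\operatorname{tr}(B_j\pi B_j^\dagger)$, $\pi_j'=\frac1{p_j}B_j\pi B_j^\dagger$ for $p_j\ne0$. Then: 1. (Entanglement monotonicity.) For every nonempty down-set $\vec\alpha$, $E_{\vec\alpha}$ is nonincreasing on average under pure LOCC: $\sum_{j:\,p_j\neq 0}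 p_j E_{\vec\alpha}(\pi_j')\le E_{\vec\alpha}(\pi)$ for every pure state $\pi$ and every ensemble obtained from $\pi$ by a pure LOCC protocol (for all local dimensions). 2. (Discriminance.) For every nonempty down-set $\vec\alpha$ and every $\pi\in\mathcal P$: $E_{\vec\alpha}(\pi)=0$ if and only if $\pi\in\mathcal P_{\vec\alpha}$. 3. (Multipartite monotonicity of the second kind.) For all nonempty down-sets $\vec\alpha,\vec\beta$: $\vec\beta\preceq\vec\alpha$ if and only if $E_{\vec\beta}(\pi)\ge E_{\vec\alpha}(\pi)$ for all $\pi\in\mathcal P$. 4. (Multipartite monotonicity of the first kind.) For all partitions $\alpha,\beta$: $\beta\preceq\alpha$ if and only if $E_\beta(\pi)\ge E_\alpha(\pi)$ for all $\pi\in\mathcal P$. -/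

import Mathlib

open scoped Matrix

noncomputable section

namespace MultipartiteEntanglement

/-- Configurations of all elementary subsystems: the index set of the product orthonormal basis of
`H = ⨂ a, ℂ ^ (d a)`. -/
abbrev Cfg {n : ℕ} (d : Fin n → ℕ) : Type := (a : Fin n) → Fin (d a)

/-- Configurations of the subsystem `K`: the index set of the product orthonormal basis of
`H_K = ⨂ a ∈ K, ℂ ^ (d a)`. -/
abbrev SubCfg {n : ℕ} (d : Fin n → ℕ) (K : Finset (Fin n)) : Type :=
  (a : {a : Fin n // a ∈ K}) → Fin (d a)

/-- Linear operators on `H`, as matrices in the product basis. -/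
abbrev Op {n : ℕ} (d : Fin n → ℕ) : Type := Matrix (Cfg d) (Cfg d) ℂ

/-- Linear operators on `H_K`, as matrices in the product basis. -/
abbrev SubOp {n : ℕ} (d : Fin n → ℕ) (K : Finset (Fin n)) : Type :=
  Matrix (SubCfg d K) (SubCfg d K) ℂ

/-- Pure states: self-adjoint projectors of unit trace. -/
def IsPureState {ι : Type*} [Fintype ι] (P : Matrix ι ι ℂ) : Prop :=
  P.IsHermitian ∧ P * P = P ∧ P.trace = 1

/-- The configuration of the whole system which is `x` on `K` and `z` off `K`. -/
def glue {n : ℕ} {d : Fin n → ℕ} {K : Finset (Fin n)} (x : SubCfg d K)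
    (z : (a : {a : Fin n // a ∉ K}) → Fin (d a)) : Cfg d :=
  fun a => if h : a ∈ K then x ⟨a, h⟩ else z ⟨a, h⟩

/-- The reduced operator on the subsystem `K`: the partial trace over the complement of `K`. -/
def reduced {n : ℕ} {d : Fin n → ℕ} (K : Finset (Fin n)) (X : Op d) : SubOp d K :=
  Matrix.of fun x y => ∑ z : ((a : {a : Fin n // a ∉ K}) → Fin (d a)), X (glue x z) (glue y z)

/-- The von Neumann entropy `S(ρ) = -tr (ρ ln ρ)` (with `0 ln 0 = 0`), for self-adjoint `ρ`. -/
def vonNeumannEntropy {ι : Type*} [Fintype ι] [DecidableEq ι] (ρ : Matrix ι ι ℂ) : ℝ :=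
  -(ρ * cfc Real.log ρ).trace.re

/-- Labels of the first kind: partitions of the set of elementary subsystems into nonempty parts.
The order is refinement: `β ≤ α` iff every part of `β` is contained in a part of `α`. -/
abbrev LabelI (n : ℕ) : Type := Finpartition (Finset.univ : Finset (Fin n))

/-- Labels of the second kind: nonempty down-sets of partitions, ordered by inclusion. -/
abbrev LabelII (n : ℕ) : Type := {A : LowerSet (LabelI n) // (A : Set (LabelI n)).Nonempty}

/-- The tensor product of the operators `ω K` on `H_K`, over the parts `K` of the partition `α`. -/
def tensor {n : ℕ} {d : Fin n → ℕ} (α : LabelI n) (ω : (K : Finset (Fin n)) → SubOp d K) : Op d :=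
  Matrix.of fun x y => ∏ K ∈ α.parts, ω K (fun a => x a) (fun a => y a)

/-- The `α`-separable pure states, for a partition `α`. -/
def pureSepI {n : ℕ} (d : Fin n → ℕ) (α : LabelI n) : Set (Op d) :=
  {P | ∃ ω : (K : Finset (Fin n)) → SubOp d K,
    (∀ K ∈ α.parts, IsPureState (ω K)) ∧ P = tensor α ω}

/-- The `A`-separable pure states, for a nonempty down-set `A` of partitions. -/
def pureSepII {n : ℕ} (d : Fin n → ℕ) (A : LabelII n) : Set (Op d) :=
  ⋃ α ∈ A.1, pureSepI d α

/-- The `α`-entanglement entropy of a pure state. -/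
def entI {n : ℕ} {d : Fin n → ℕ} (α : LabelI n) (P : Op d) : ℝ :=
  1 / 2 * ∑ K ∈ α.parts, vonNeumannEntropy (reduced K P)

/-- The entanglement entropy with respect to a nonempty down-set `A` of partitions: the minimum of
`entI α P` over `α ∈ A` (attained, see `entII_isLeast`). -/
def entII {n : ℕ} {d : Fin n → ℕ} (A : LabelII n) (P : Op d) : ℝ :=
  sInf ((fun α => entI α P) '' (A.1 : Set (LabelI n)))

/-- The infimum in the definition of `entII` is a minimum. -/
theorem entII_isLeast {n : ℕ} {d : Fin n → ℕ} (A : LabelII n) (P : Op d) :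
    IsLeast ((fun α => entI α P) '' (A.1 : Set (LabelI n))) (entII A P) := by
  have hf : ((fun α => entI α P) '' (A.1 : Set (LabelI n))).Finite := Set.toFinite _
  have hne : ((fun α => entI α P) '' (A.1 : Set (LabelI n))).Nonempty := A.2.image _
  exact ⟨hne.csInf_mem hf, fun x hx => csInf_le hf.bddBelow hx⟩

/-- The operator `M ⊗ 1` acting by `M : ℂ ^ (d a) → ℂ ^ (c a)` on the elementary subsystem `a` and
trivially on the others. It is used for `c b = d b` for all `b ≠ a`. -/
def localOp {n : ℕ} {d c : Fin n → ℕ} (a : Fin n) (M : Matrix (Fin (c a)) (Fin (d a)) ℂ) :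
    Matrix (Cfg c) (Cfg d) ℂ :=
  Matrix.of fun x y => open Classical in
    if ∀ b, b ≠ a → (x b : ℕ) = (y b : ℕ) then M (x a) (y a) else 0

/-- `IsPureLOCC e d Λ`: the list `Λ` consists of the Kraus operators, one for each outcome, of an
LOCC protocol with finitely many rounds and pure suboperations, from `⨂ a, ℂ ^ (d a)` to
`⨂ a, ℂ ^ (e a)`. In each round some party `a` performs a local measurement with Kraus operators
`M i` and announces the outcome `i`, on which everything done later may depend. The dimension of the
measured subsystem may change, so that local ancillas may be attached, kept and removed. -/
inductive IsPureLOCC {n : ℕ} (e : Fin n → ℕ) :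
    (d : Fin n → ℕ) → List (Matrix (Cfg e) (Cfg d) ℂ) → Prop
  | done : IsPureLOCC e e [1]
  | round {d : Fin n → ℕ} (a : Fin n) {m : ℕ} (c : Fin m → Fin n → ℕ)
      (hc : ∀ i b, b ≠ a → c i b = d b)
      (M : (i : Fin m) → Matrix (Fin (c i a)) (Fin (d a)) ℂ)
      (hM : ∑ i, (M i)ᴴ * M i = 1)
      (rest : (i : Fin m) → List (Matrix (Cfg e) (Cfg (c i)) ℂ))
      (hrest : ∀ i, IsPureLOCC e (c i) (rest i)) :
      IsPureLOCC e d (List.ofFn fun i => (rest i).map fun B => B * localOp a (M i)).flatten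

/-- The probability of the outcome with Kraus operator `B` on the state `P`. -/
def outcomeProb {n : ℕ} {d e : Fin n → ℕ} (B : Matrix (Cfg e) (Cfg d) ℂ) (P : Op d) : ℝ :=
  (B * P * Bᴴ).trace.re

/-- The state after the outcome with Kraus operator `B` on the state `P` (meaningful if this outcome
has nonzero probability). -/
def outcomeState {n : ℕ} {d e : Fin n → ℕ} (B : Matrix (Cfg e) (Cfg d) ℂ) (P : Op d) : Op e :=
  ((outcomeProb B P : ℂ)⁻¹) • (B * P * Bᴴ)

/-- `f`, a function of pure states given for all local dimensions, is nonincreasing on average under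
pure LOCC. Outcomes of probability zero contribute zero to the sum. -/
def IsPureEntanglementMonotone {n : ℕ} (f : (d : Fin n → ℕ) → Op d → ℝ) : Prop :=
  ∀ (d e : Fin n → ℕ) (Λ : List (Matrix (Cfg e) (Cfg d) ℂ)), IsPureLOCC e d Λ →
    ∀ P : Op d, IsPureState P →
      (Λ.map fun B => outcomeProb B P * f e (outcomeState B P)).sum ≤ f d P

end MultipartiteEntanglement

end

open MultipartiteEntanglement

/-!
The entropy of a state is a function of its eigenvalues, and of its characteristic polynomial only,
so it is invariant under relabelling, transposition and unitary conjugation, and `Ψ Ψ†` and `Ψ† Ψ`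
have the same entropy. The one analytic fact needed is that the entropy is at most the Shannon
entropy of the diagonal (`vonNeumannEntropy_le_sum_diag`); evaluated in suitable eigenbases it gives
concavity (`sum_mul_vonNeumannEntropy_le`) and, with the inequality of Gibbs, subadditivity
(`vonNeumannEntropy_subadditive`).

*Refinement.* A part of a coarser partition is a disjoint union of parts of a finer one, so by
subadditivity the entropy `entI` can only grow under refinement (`entI_anti`).

*Separability.* For `P = |ψ⟩⟨ψ|`, purity of the reduced state on `K` means that the `2 × 2` minors
of the coefficient matrix of `ψ` vanish, that is `ψ x * ψ y = ψ (x_K y) * ψ (y_K x)`, where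
`x_K y` is `x` on `K` and `y` off `K`. If this holds for all parts of `α`, then `ψ` is the product
of its slices through a point where it does not vanish (`entI_eq_zero_iff`).

*Converse directions.* The product over the parts of `β` of GHZ states is `α`-separable exactly when
`β ≤ α` (`exists_isPureState_entI_eq_zero_iff`). So if `β ≰ α`, this state has zero entropy with
respect to `β` and positive entropy with respect to `α`. If `β` lies in the down-set `B` and not in
`A`, its entropy vanishes for `B` and is positive for `A`.

*LOCC.* By induction on the protocol one round suffices. A measurement by the party `a` preserves
the average reduced state of every `K` not containing `a` (`sum_reduced_localOp`), so concavity
bounds the average entropy. If `a ∈ K`, pass to the complement of `K`, which has the same entropy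
because the global states are pure (`vonNeumannEntropy_reduced_compl`).
-/

namespace MultipartiteEntanglement

open Matrix Real
open scoped ComplexOrder

/-! ### Concavity and subadditivity of the entropy -/

/-- Gibbs' inequality for a joint distribution and the product of its marginals. -/
theorem sum_negMulLog_le_marginals {ι κ : Type*} [Fintype ι] [Fintype κ] (q : ι × κ → ℝ)
    (hq : ∀ x, 0 ≤ q x) (hq1 : ∑ x, q x = 1) :
    ∑ x, negMulLog (q x) ≤
      ∑ i, negMulLog (∑ j, q (i, j)) + ∑ j, negMulLog (∑ i, q (i, j)) := by
  set a : ι → ℝ := fun i => ∑ j, q (i, j) with ha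
  set b : κ → ℝ := fun j => ∑ i, q (i, j) with hb
  have ha0 : ∀ i, 0 ≤ a i := fun i => Finset.sum_nonneg fun j _ => hq _
  have hb0 : ∀ j, 0 ≤ b j := fun j => Finset.sum_nonneg fun i _ => hq _
  have ha1 : ∑ i, a i = 1 := by rw [← hq1, Fintype.sum_prod_type]
  have hb1 : ∑ j, b j = 1 := by rw [← hq1, Fintype.sum_prod_type_right]
  have hA : ∑ i, negMulLog (a i) = ∑ x : ι × κ, -(q x * log (a x.1)) := by
    rw [Fintype.sum_prod_type]
    refine Finset.sum_congr rfl fun i _ => ?_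
    rw [Finset.sum_neg_distrib, negMulLog, neg_mul, Finset.sum_mul]
  have hB : ∑ j, negMulLog (b j) = ∑ x : ι × κ, -(q x * log (b x.2)) := by
    rw [Fintype.sum_prod_type_right]
    refine Finset.sum_congr rfl fun j _ => ?_
    rw [Finset.sum_neg_distrib, negMulLog, neg_mul, Finset.sum_mul]
  -- `log t ≤ t - 1` at `t = a b / q`; where `q` vanishes, so does the left-hand side
  have key : ∀ x : ι × κ, negMulLog (q x) + q x * log (a x.1) + q x * log (b x.2)
      ≤ a x.1 * b x.2 - q x := fun x => by
    rcases (hq x).eq_or_lt with h | h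
    · rw [← h]; simpa using mul_nonneg (ha0 _) (hb0 _)
    · have h1 : 0 < a x.1 := h.trans_le
        (Finset.single_le_sum (f := fun j => q (x.1, j)) (fun j _ => hq _) (Finset.mem_univ x.2))
      have h2 : 0 < b x.2 := h.trans_le
        (Finset.single_le_sum (f := fun i => q (i, x.2)) (fun j _ => hq _) (Finset.mem_univ x.1))
      have h3 := mul_le_mul_of_nonneg_left
        (log_le_sub_one_of_pos (div_pos (mul_pos h1 h2) h)) (hq x)
      rw [log_div (mul_pos h1 h2).ne' h.ne', log_mul h1.ne' h2.ne', mul_sub,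
        mul_sub, mul_div_cancel₀ _ h.ne', mul_one] at h3
      rw [negMulLog]
      linarith
  have hsum := Finset.sum_le_sum fun x (_ : x ∈ Finset.univ) => key x
  have hab : ∑ x : ι × κ, a x.1 * b x.2 = 1 := by
    rw [Fintype.sum_prod_type]
    simp_rw [← Finset.mul_sum, hb1, mul_one, ha1]
  rw [Finset.sum_sub_distrib, hab, hq1, Finset.sum_add_distrib, Finset.sum_add_distrib] at hsum
  rw [hA, hB, Finset.sum_neg_distrib, Finset.sum_neg_distrib]
  linarith

section Entropy

variable {ι κ : Type*} [Fintype ι] [Fintype κ] [DecidableEq ι] [DecidableEq κ]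

theorem vonNeumannEntropy_eq_sum_eigenvalues {ρ : Matrix ι ι ℂ} (hρ : ρ.IsHermitian) :
    vonNeumannEntropy ρ = ∑ i, negMulLog (hρ.eigenvalues i) := by
  have h : ρ * cfc Real.log ρ = Unitary.conjStarAlgAut ℂ _ hρ.eigenvectorUnitary
      (diagonal fun i => ((hρ.eigenvalues i * log (hρ.eigenvalues i) : ℝ) : ℂ)) := by
    rw [hρ.cfc_eq, IsHermitian.cfc]
    conv_lhs => enter [1]; rw [hρ.spectral_theorem]
    rw [← map_mul, diagonal_mul_diagonal]
    simp
  rw [vonNeumannEntropy, h, Unitary.conjStarAlgAut_apply, trace_mul_cycle]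
  simp [trace_diagonal, negMulLog, -Complex.ofReal_mul]

/-- The entropy depends on the characteristic polynomial only. -/
theorem vonNeumannEntropy_eq_sum_roots {ρ : Matrix ι ι ℂ} (hρ : ρ.IsHermitian) :
    vonNeumannEntropy ρ = (ρ.charpoly.roots.map fun z => negMulLog z.re).sum := by
  rw [vonNeumannEntropy_eq_sum_eigenvalues hρ, hρ.roots_charpoly_eq_eigenvalues]
  rw [Multiset.map_map]
  rfl

theorem vonNeumannEntropy_submatrix {ρ : Matrix ι ι ℂ} (hρ : ρ.IsHermitian) (e : κ ≃ ι) :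
    vonNeumannEntropy (ρ.submatrix e e) = vonNeumannEntropy ρ := by
  rw [vonNeumannEntropy_eq_sum_roots hρ, vonNeumannEntropy_eq_sum_roots (hρ.submatrix e),
    ← charpoly_reindex e.symm ρ]
  rfl

theorem vonNeumannEntropy_transpose {ρ : Matrix ι ι ℂ} (hρ : ρ.IsHermitian) :
    vonNeumannEntropy ρᵀ = vonNeumannEntropy ρ := by
  rw [vonNeumannEntropy_eq_sum_roots hρ, vonNeumannEntropy_eq_sum_roots hρ.transpose,
    charpoly_transpose]

/-- `Ψ Ψ†` and `Ψ† Ψ` have the same nonzero eigenvalues, hence the same entropy. -/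
theorem vonNeumannEntropy_mul_conjTranspose_self (Ψ : Matrix ι κ ℂ) :
    vonNeumannEntropy (Ψ * Ψᴴ) = vonNeumannEntropy (Ψᴴ * Ψ) := by
  rw [vonNeumannEntropy_eq_sum_roots (isHermitian_mul_conjTranspose_self Ψ),
    vonNeumannEntropy_eq_sum_roots (isHermitian_conjTranspose_mul_self Ψ)]
  have h := congrArg (fun p => (p.roots.map fun z : ℂ => negMulLog z.re).sum)
    (charpoly_mul_comm' Ψ Ψᴴ)
  have hne : ∀ (k : ℕ) (p : Polynomial ℂ), p.Monic → Polynomial.X ^ k * p ≠ 0 :=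
    fun k p hp => ((Polynomial.monic_X_pow k).mul hp).ne_zero
  simpa [Polynomial.roots_mul (hne _ _ (charpoly_monic _)), Polynomial.roots_X_pow,
    Multiset.map_nsmul, Multiset.sum_nsmul] using h

theorem vonNeumannEntropy_unitary_conj {ρ : Matrix ι ι ℂ} (hρ : ρ.IsHermitian)
    {U : Matrix ι ι ℂ} (hU : U * Uᴴ = 1) :
    vonNeumannEntropy (Uᴴ * ρ * U) = vonNeumannEntropy ρ := by
  rw [vonNeumannEntropy_eq_sum_roots hρ,
    vonNeumannEntropy_eq_sum_roots (isHermitian_conjTranspose_mul_mul U hρ),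
    charpoly_mul_comm, ← mul_assoc, hU, one_mul]

/-- Measuring in the given basis does not decrease the entropy: the diagonal of `ρ` arises from the
eigenvalues by a doubly stochastic matrix, and `negMulLog` is concave. -/
theorem vonNeumannEntropy_le_sum_diag {ρ : Matrix ι ι ℂ} (hρ : ρ.PosSemidef) :
    vonNeumannEntropy ρ ≤ ∑ k, negMulLog (ρ k k).re := by
  set U : Matrix ι ι ℂ := hρ.1.eigenvectorUnitary.1 with hU
  have hUU : U * Uᴴ = 1 := Unitary.coe_mul_star_self hρ.1.eigenvectorUnitary
  have hUU' : Uᴴ * U = 1 := Unitary.coe_star_mul_self hρ.1.eigenvectorUnitary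
  have hspec : ρ = U * diagonal (RCLike.ofReal ∘ hρ.1.eigenvalues) * Uᴴ := by
    conv_lhs => rw [hρ.1.spectral_theorem, Unitary.conjStarAlgAut_apply]
    rfl
  set w : ι → ι → ℝ := fun k l => Complex.normSq (U k l) with hw
  have hw_row : ∀ k, ∑ l, w k l = 1 := fun k => by
    have := congrFun (congrFun hUU k) k
    rw [mul_apply, one_apply_eq] at this
    apply Complex.ofReal_injective
    simpa [hw, ← Complex.mul_conj] using this
  have hw_col : ∀ l, ∑ k, w k l = 1 := fun l => by
    have := congrFun (congrFun hUU' l) l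
    rw [mul_apply, one_apply_eq] at this
    apply Complex.ofReal_injective
    simpa [hw, ← Complex.mul_conj, mul_comm] using this
  have hdiag : ∀ k, (ρ k k).re = ∑ l, w k l * hρ.1.eigenvalues l := fun k => by
    apply Complex.ofReal_injective
    have h1 : ρ k k = ∑ l, (w k l * hρ.1.eigenvalues l : ℂ) := by
      conv_lhs => rw [hspec, mul_apply]
      refine Finset.sum_congr rfl fun l _ => ?_
      simp [hw, ← Complex.mul_conj]
      ring
    rw [h1]
    simp
  rw [vonNeumannEntropy_eq_sum_eigenvalues hρ.1]
  calc ∑ l, negMulLog (hρ.1.eigenvalues l)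
      = ∑ l, ∑ k, w k l * negMulLog (hρ.1.eigenvalues l) := by
        simp_rw [← Finset.sum_mul, hw_col, one_mul]
    _ = ∑ k, ∑ l, w k l * negMulLog (hρ.1.eigenvalues l) := Finset.sum_comm
    _ ≤ _ := Finset.sum_le_sum fun k _ => by
      rw [hdiag]
      exact concaveOn_negMulLog.le_map_sum (fun l _ => Complex.normSq_nonneg _) (hw_row k)
        fun l _ => hρ.eigenvalues_nonneg l

/-- In an eigenbasis the entropy is the Shannon entropy of the diagonal. -/
theorem exists_unitary_vonNeumannEntropy_eq {ρ : Matrix ι ι ℂ} (hρ : ρ.IsHermitian) :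
    ∃ U : Matrix ι ι ℂ, U * Uᴴ = 1 ∧
      vonNeumannEntropy ρ = ∑ k, negMulLog ((Uᴴ * ρ * U) k k).re := by
  obtain ⟨U, hU⟩ : ∃ U : Matrix ι ι ℂ, U = hρ.eigenvectorUnitary := ⟨_, rfl⟩
  have h : Uᴴ * ρ * U = diagonal (RCLike.ofReal ∘ hρ.eigenvalues) := by
    have := hρ.conjStarAlgAut_star_eigenvectorUnitary
    rw [Unitary.conjStarAlgAut_apply] at this
    simpa [star_eq_conjTranspose, hU] using this
  refine ⟨U, hU ▸ Unitary.coe_mul_star_self hρ.eigenvectorUnitary, ?_⟩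
  rw [vonNeumannEntropy_eq_sum_eigenvalues hρ, h]
  simp

/-- Concavity of the entropy. -/
theorem sum_mul_vonNeumannEntropy_le {τ : Type*} [Fintype τ] (p : τ → ℝ) (hp : ∀ i, 0 ≤ p i)
    (hp1 : ∑ i, p i = 1) (ρ : τ → Matrix ι ι ℂ) (hρ : ∀ i, (ρ i).PosSemidef) :
    ∑ i, p i * vonNeumannEntropy (ρ i) ≤ vonNeumannEntropy (∑ i, (p i : ℂ) • ρ i) := by
  have hσ : (∑ i, (p i : ℂ) • ρ i).PosSemidef :=
    posSemidef_sum _ fun i _ => (hρ i).smul (by exact_mod_cast hp i)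
  obtain ⟨U, hU, hS⟩ := exists_unitary_vonNeumannEntropy_eq hσ.1
  have hdiag : ∀ k, ((Uᴴ * (∑ i, (p i : ℂ) • ρ i) * U) k k).re =
      ∑ i, p i * ((Uᴴ * ρ i * U) k k).re := fun k => by
    simp [Finset.mul_sum, Finset.sum_mul, Matrix.sum_apply]
  rw [hS]
  calc ∑ i, p i * vonNeumannEntropy (ρ i)
      ≤ ∑ i, p i * ∑ k, negMulLog ((Uᴴ * ρ i * U) k k).re := by
        refine Finset.sum_le_sum fun i _ => mul_le_mul_of_nonneg_left ?_ (hp i)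
        rw [← vonNeumannEntropy_unitary_conj (hρ i).1 hU]
        exact vonNeumannEntropy_le_sum_diag ((hρ i).conjTranspose_mul_mul_same U)
    _ = ∑ k, ∑ i, p i * negMulLog ((Uᴴ * ρ i * U) k k).re := by
        simp_rw [Finset.mul_sum]; exact Finset.sum_comm
    _ ≤ _ := Finset.sum_le_sum fun k _ => by
        rw [hdiag]
        exact concaveOn_negMulLog.le_map_sum (fun i _ => hp i) hp1 fun i _ =>
          (Complex.nonneg_iff.1 (((hρ i).conjTranspose_mul_mul_same U).diag_nonneg)).1

/-- Subadditivity of the entropy: pass to the product of the eigenbases of the two reduced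
operators, where it becomes the classical inequality for a joint distribution. -/
theorem vonNeumannEntropy_subadditive {ρ : Matrix (ι × κ) (ι × κ) ℂ} (hρ : ρ.PosSemidef)
    (htr : ρ.trace = 1) {ρA : Matrix ι ι ℂ} {ρB : Matrix κ κ ℂ}
    (hA : ∀ i i', ρA i i' = ∑ j, ρ (i, j) (i', j)) (hB : ∀ j j', ρB j j' = ∑ i, ρ (i, j) (i, j')) :
    vonNeumannEntropy ρ ≤ vonNeumannEntropy ρA + vonNeumannEntropy ρB := by
  have hAh : ρA.IsHermitian := by
    ext i i'
    simp only [conjTranspose_apply, hA, star_sum]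
    exact Finset.sum_congr rfl fun j _ => hρ.1.apply _ _
  have hBh : ρB.IsHermitian := by
    ext i i'
    simp only [conjTranspose_apply, hB, star_sum]
    exact Finset.sum_congr rfl fun j _ => hρ.1.apply _ _
  obtain ⟨U, hU, hSA⟩ := exists_unitary_vonNeumannEntropy_eq hAh
  obtain ⟨V, hV, hSB⟩ := exists_unitary_vonNeumannEntropy_eq hBh
  have hUV : kroneckerMap (· * ·) U V * (kroneckerMap (· * ·) U V)ᴴ = 1 := by
    rw [conjTranspose_kronecker, ← mul_kronecker_mul, hU, hV, one_kronecker_one]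
  have hUe : ∀ k k', ∑ i, U k i * star (U k' i) = if k = k' then 1 else 0 := fun k k' => by
    simpa [mul_apply, one_apply] using congrFun (congrFun hU k) k'
  have hVe : ∀ k k', ∑ i, V k i * star (V k' i) = if k = k' then 1 else 0 := fun k k' => by
    simpa [mul_apply, one_apply] using congrFun (congrFun hV k) k'
  set W := kroneckerMap (· * ·) U V with hW
  have hpsd : (Wᴴ * ρ * W).PosSemidef := hρ.conjTranspose_mul_mul_same W
  have hq0 : ∀ x, 0 ≤ ((Wᴴ * ρ * W) x x).re := fun x =>
    (Complex.nonneg_iff.1 hpsd.diag_nonneg).1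
  have hq1 : ∑ x, ((Wᴴ * ρ * W) x x).re = 1 := by
    have h1 : (Wᴴ * ρ * W).trace = 1 := by rw [trace_mul_cycle, hUV, one_mul, htr]
    simpa [trace] using congrArg Complex.re h1
  have hentry : ∀ x, (Wᴴ * ρ * W) x x = ∑ k', ∑ l', ∑ k, ∑ l,
      (U k' x.1 * star (U k x.1)) * (V l' x.2 * star (V l x.2)) * ρ (k, l) (k', l') := fun x => by
    rw [mul_apply, Fintype.sum_prod_type]
    refine Finset.sum_congr rfl fun k' _ => Finset.sum_congr rfl fun l' _ => ?_
    rw [mul_apply, Fintype.sum_prod_type, Finset.sum_mul]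
    refine Finset.sum_congr rfl fun k _ => ?_
    rw [Finset.sum_mul]
    refine Finset.sum_congr rfl fun l _ => ?_
    simp [hW, kroneckerMap_apply, conjTranspose_apply]
    ring
  have hmA : ∀ i, ∑ j, ((Wᴴ * ρ * W) (i, j) (i, j)).re = ((Uᴴ * ρA * U) i i).re := fun i => by
    rw [← Complex.re_sum]
    congr 1
    simp_rw [hentry, mul_apply, conjTranspose_apply, Finset.sum_mul, hA, Finset.mul_sum,
      Finset.sum_mul]
    rw [Finset.sum_comm]
    refine Finset.sum_congr rfl fun k' _ => ?_
    have : ∀ j, ∑ l', ∑ k, ∑ l,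
        (U k' i * star (U k i)) * (V l' j * star (V l j)) * ρ (k, l) (k', l') =
        ∑ k, ∑ l', ∑ l,
        (U k' i * star (U k i)) * (V l' j * star (V l j)) * ρ (k, l) (k', l') :=
      fun j => Finset.sum_comm
    simp_rw [this]
    rw [Finset.sum_comm]
    refine Finset.sum_congr rfl fun k _ => ?_
    rw [Finset.sum_comm]
    refine Finset.sum_congr rfl fun l' _ => ?_
    rw [Finset.sum_comm]
    simp_rw [← Finset.sum_mul, ← Finset.mul_sum, hVe]
    simp
    ring
  have hmB : ∀ j, ∑ i, ((Wᴴ * ρ * W) (i, j) (i, j)).re = ((Vᴴ * ρB * V) j j).re := fun j => by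
    rw [← Complex.re_sum]
    congr 1
    simp_rw [hentry, mul_apply, conjTranspose_apply, Finset.sum_mul, hB, Finset.mul_sum,
      Finset.sum_mul]
    have : ∀ i, ∑ k', ∑ l', ∑ k, ∑ l,
        (U k' i * star (U k i)) * (V l' j * star (V l j)) * ρ (k, l) (k', l') =
        ∑ l', ∑ l, ∑ k', ∑ k,
        (U k' i * star (U k i)) * (V l' j * star (V l j)) * ρ (k, l) (k', l') := fun i => by
      rw [Finset.sum_comm]
      exact Finset.sum_congr rfl fun l' _ =>
        (Finset.sum_congr rfl fun k' _ => Finset.sum_comm).trans Finset.sum_comm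
    simp_rw [this]
    rw [Finset.sum_comm]
    refine Finset.sum_congr rfl fun l' _ => ?_
    rw [Finset.sum_comm]
    refine Finset.sum_congr rfl fun l _ => ?_
    rw [Finset.sum_comm]
    refine Finset.sum_congr rfl fun k' _ => ?_
    rw [Finset.sum_comm]
    have : ∀ k, ∑ i, (U k' i * star (U k i)) * (V l' j * star (V l j)) * ρ (k, l) (k', l') =
      if k' = k then (V l' j * star (V l j)) * ρ (k, l) (k', l') else 0 := fun k => by
      simp_rw [mul_assoc (U k' _ * _), ← Finset.sum_mul, hUe]
      simp
    simp_rw [this]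
    simp
    ring
  calc vonNeumannEntropy ρ = vonNeumannEntropy (Wᴴ * ρ * W) :=
        (vonNeumannEntropy_unitary_conj hρ.1 hUV).symm
    _ ≤ ∑ x, negMulLog ((Wᴴ * ρ * W) x x).re := vonNeumannEntropy_le_sum_diag hpsd
    _ ≤ _ := sum_negMulLog_le_marginals _ hq0 hq1
    _ = _ := by rw [hSA, hSB]; simp_rw [hmA, hmB]

theorem eigenvalues_le_one {ρ : Matrix ι ι ℂ} (hρ : ρ.PosSemidef) (htr : ρ.trace = 1) (i : ι) :
    hρ.1.eigenvalues i ≤ 1 := by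
  have h : ∑ i, hρ.1.eigenvalues i = 1 := by
    apply Complex.ofReal_injective
    simpa [hρ.1.trace_eq_sum_eigenvalues] using htr
  rw [← h]
  exact Finset.single_le_sum (fun j _ => hρ.eigenvalues_nonneg j) (Finset.mem_univ i)

theorem vonNeumannEntropy_nonneg {ρ : Matrix ι ι ℂ} (hρ : ρ.PosSemidef) (htr : ρ.trace = 1) :
    0 ≤ vonNeumannEntropy ρ := by
  rw [vonNeumannEntropy_eq_sum_eigenvalues hρ.1]
  exact Finset.sum_nonneg fun i _ =>
    negMulLog_nonneg (hρ.eigenvalues_nonneg i) (eigenvalues_le_one hρ htr i)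

/-- A state has zero entropy if and only if its purity `tr ρ²` equals one: both say that all
eigenvalues are `0` or `1`. -/
theorem vonNeumannEntropy_eq_zero_iff {ρ : Matrix ι ι ℂ} (hρ : ρ.PosSemidef)
    (htr : ρ.trace = 1) : vonNeumannEntropy ρ = 0 ↔ (ρ * ρ).trace = 1 := by
  set μ := hρ.1.eigenvalues with hμ
  have h0 : ∀ i, 0 ≤ μ i := hρ.eigenvalues_nonneg
  have h1 : ∀ i, μ i ≤ 1 := eigenvalues_le_one hρ htr
  have hs : ∑ i, μ i = 1 := by
    apply Complex.ofReal_injective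
    simpa [hρ.1.trace_eq_sum_eigenvalues] using htr
  have hsq : (ρ * ρ).trace = ((∑ i, μ i * μ i : ℝ) : ℂ) := by
    have h : ρ * ρ = Unitary.conjStarAlgAut ℂ _ hρ.1.eigenvectorUnitary
        (diagonal fun i => ((μ i * μ i : ℝ) : ℂ)) := by
      conv_lhs => rw [hρ.1.spectral_theorem]
      rw [← map_mul, diagonal_mul_diagonal]
      simp [hμ]
    rw [h, Unitary.conjStarAlgAut_apply, trace_mul_cycle]
    simp [trace_diagonal]
  have hpur : (ρ * ρ).trace = 1 ↔ ∑ i, (μ i - μ i * μ i) = 0 := by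
    rw [hsq, Finset.sum_sub_distrib, hs, sub_eq_zero, ← Complex.ofReal_one,
      Complex.ofReal_inj, eq_comm]
  rw [hpur, vonNeumannEntropy_eq_sum_eigenvalues hρ.1,
    Finset.sum_eq_zero_iff_of_nonneg fun i _ => negMulLog_nonneg (h0 i) (h1 i),
    Finset.sum_eq_zero_iff_of_nonneg fun i _ => by nlinarith [h0 i, h1 i]]
  refine forall₂_congr fun i _ => ?_
  rw [negMulLog, mul_eq_zero, neg_eq_zero, log_eq_zero,
    show μ i - μ i * μ i = μ i * (1 - μ i) by ring, mul_eq_zero, sub_eq_zero]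
  constructor
  · rintro (h | h | h | h)
    · exact Or.inl h
    · exact Or.inl h
    · exact Or.inr h.symm
    · linarith [h0 i]
  · rintro (h | h)
    · exact Or.inl h
    · exact Or.inr (Or.inr (Or.inl h.symm))

end Entropy

/-! ### Pure states and rank one operators -/

/-- The rank one operator `|ψ⟩⟨ψ|`. -/
def ketbra {ι : Type*} (ψ : ι → ℂ) : Matrix ι ι ℂ :=
  vecMulVec ψ (star ψ)

theorem ketbra_apply {ι : Type*} (ψ : ι → ℂ) (x y : ι) : ketbra ψ x y = ψ x * star (ψ y) :=
  rfl

theorem posSemidef_ketbra {ι : Type*} [Fintype ι] (ψ : ι → ℂ) : (ketbra ψ).PosSemidef :=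
  posSemidef_vecMulVec_self_star ψ

theorem trace_ketbra {ι : Type*} [Fintype ι] (ψ : ι → ℂ) :
    (ketbra ψ).trace = ((∑ x, Complex.normSq (ψ x) : ℝ) : ℂ) := by
  simp [trace, ketbra_apply, Complex.mul_conj]

theorem isPureState_ketbra {ι : Type*} [Fintype ι] {ψ : ι → ℂ} (h : (ketbra ψ).trace = 1) :
    IsPureState (ketbra ψ) := by
  refine ⟨(posSemidef_ketbra ψ).1, ?_, h⟩
  have h1 : star ψ ⬝ᵥ ψ = 1 := by
    rw [← h, ketbra, trace_vecMulVec, dotProduct_comm]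
  rw [ketbra, vecMulVec_mul_vecMulVec, h1, one_smul]

/-- The `2 × 2` minors of `Ψ` measure the deviation of `Ψ Ψ†` from purity:
`∑ |minor|² = 2 (tr Ψ Ψ†)² - 2 tr (Ψ Ψ†)²`. -/
theorem sum_normSq_minors {ι κ : Type*} [Fintype ι] [Fintype κ] (Ψ : Matrix ι κ ℂ) :
    ((∑ u, ∑ u', ∑ z, ∑ z', Complex.normSq (Ψ u z * Ψ u' z' - Ψ u z' * Ψ u' z) : ℝ) : ℂ) =
      2 * (Ψ * Ψᴴ).trace ^ 2 - 2 * (Ψ * Ψᴴ * (Ψ * Ψᴴ)).trace := by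
  have hent : ∀ u u', (Ψ * Ψᴴ) u u' = ∑ z, Ψ u z * star (Ψ u' z) := fun u u' => rfl
  have hinner : ∀ u u', ((∑ z, ∑ z', Complex.normSq (Ψ u z * Ψ u' z' - Ψ u z' * Ψ u' z) : ℝ) : ℂ) =
      2 * ((Ψ * Ψᴴ) u u * (Ψ * Ψᴴ) u' u') - 2 * ((Ψ * Ψᴴ) u u' * (Ψ * Ψᴴ) u' u) := fun u u' => by
    have e1 := Finset.sum_mul_sum Finset.univ Finset.univ
      (fun z => Ψ u z * star (Ψ u z)) fun z => Ψ u' z * star (Ψ u' z)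
    have e2 := Finset.sum_mul_sum Finset.univ Finset.univ
      (fun z => Ψ u' z * star (Ψ u' z)) fun z => Ψ u z * star (Ψ u z)
    have e3 := Finset.sum_mul_sum Finset.univ Finset.univ
      (fun z => Ψ u z * star (Ψ u' z)) fun z => Ψ u' z * star (Ψ u z)
    have e4 := Finset.sum_mul_sum Finset.univ Finset.univ
      (fun z => Ψ u' z * star (Ψ u z)) fun z => Ψ u z * star (Ψ u' z)
    have : 2 * ((Ψ * Ψᴴ) u u * (Ψ * Ψᴴ) u' u') - 2 * ((Ψ * Ψᴴ) u u' * (Ψ * Ψᴴ) u' u) =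
        (Ψ * Ψᴴ) u u * (Ψ * Ψᴴ) u' u' + (Ψ * Ψᴴ) u' u' * (Ψ * Ψᴴ) u u -
        (Ψ * Ψᴴ) u u' * (Ψ * Ψᴴ) u' u - (Ψ * Ψᴴ) u' u * (Ψ * Ψᴴ) u u' := by ring
    rw [this]
    simp only [hent]
    rw [e1, e2, e3, e4]
    simp_rw [← Finset.sum_add_distrib, ← Finset.sum_sub_distrib]
    push_cast
    refine Finset.sum_congr rfl fun z _ => Finset.sum_congr rfl fun z' _ => ?_
    rw [← Complex.mul_conj]
    simp only [map_sub, map_mul, RCLike.star_def]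
    ring
  simp only [Complex.ofReal_sum] at hinner ⊢
  simp_rw [hinner, Finset.sum_sub_distrib, ← Finset.mul_sum,
    ← Finset.sum_mul]
  rw [pow_two]
  rfl

theorem trace_sq_eq_one_iff_minors {ι κ : Type*} [Fintype ι] [Fintype κ] {Ψ : Matrix ι κ ℂ}
    (h : (Ψ * Ψᴴ).trace = 1) : (Ψ * Ψᴴ * (Ψ * Ψᴴ)).trace = 1 ↔
      ∀ u u' z z', Ψ u z * Ψ u' z' = Ψ u z' * Ψ u' z := by
  have hid := sum_normSq_minors Ψ
  rw [h] at hid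
  have h1 : (Ψ * Ψᴴ * (Ψ * Ψᴴ)).trace = 1 ↔
      ∑ u, ∑ u', ∑ z, ∑ z', Complex.normSq (Ψ u z * Ψ u' z' - Ψ u z' * Ψ u' z) = 0 := by
    rw [← Complex.ofReal_eq_zero, hid]
    constructor
    · intro h2; rw [h2]; ring
    · intro h2; linear_combination -(1 / 2) * h2
  have hn := fun u u' z z' => Complex.normSq_nonneg (Ψ u z * Ψ u' z' - Ψ u z' * Ψ u' z)
  rw [h1]
  constructor
  · intro h2 u u' z z'
    rw [Finset.sum_eq_zero_iff_of_nonneg fun u _ => Finset.sum_nonneg fun u' _ =>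
      Finset.sum_nonneg fun z _ => Finset.sum_nonneg fun z' _ => hn u u' z z'] at h2
    have h3 := h2 u (Finset.mem_univ _)
    rw [Finset.sum_eq_zero_iff_of_nonneg fun u' _ =>
      Finset.sum_nonneg fun z _ => Finset.sum_nonneg fun z' _ => hn u u' z z'] at h3
    have h4 := h3 u' (Finset.mem_univ _)
    rw [Finset.sum_eq_zero_iff_of_nonneg fun z _ =>
      Finset.sum_nonneg fun z' _ => hn u u' z z'] at h4
    have h5 := h4 z (Finset.mem_univ _)
    rw [Finset.sum_eq_zero_iff_of_nonneg fun z' _ => hn u u' z z'] at h5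
    exact sub_eq_zero.1 (Complex.normSq_eq_zero.1 (h5 z' (Finset.mem_univ _)))
  · intro h2
    simp [h2]

/-- A pure state is given by a vector: its own `2 × 2` minors vanish, so every nonzero column spans
its range. -/
theorem IsPureState.exists_ketbra {ι : Type*} [Fintype ι] {P : Matrix ι ι ℂ}
    (hP : IsPureState P) : ∃ ψ : ι → ℂ, P = ketbra ψ := by
  obtain ⟨hH, hPP, htr⟩ := hP
  have hself : P * Pᴴ = P := by rw [hH.eq, hPP]
  have hmin := (trace_sq_eq_one_iff_minors (Ψ := P) (by rw [hself, htr])).1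
    (by rw [hself, hPP, htr])
  obtain ⟨w, hw⟩ : ∃ w, P w w ≠ 0 := by
    by_contra! hcon
    have : P.trace = 0 := Finset.sum_eq_zero fun w _ => hcon w
    rw [htr] at this
    exact one_ne_zero this
  have hpsd : P.PosSemidef := hself ▸ posSemidef_self_mul_conjTranspose P
  obtain ⟨h0, him⟩ := Complex.nonneg_iff.1 (hpsd.diag_nonneg (i := w))
  have hre : P w w = ((P w w).re : ℂ) := Complex.ext rfl him.symm
  -- the column of `w`, whose squared norm is `(Pᴴ * P) w w = P w w`
  refine ⟨fun u => P u w * ((√(P w w).re : ℝ) : ℂ)⁻¹, ?_⟩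
  ext u v
  have hsq : ((√(P w w).re : ℝ) : ℂ) * ((√(P w w).re : ℝ) : ℂ) = P w w := by
    rw [← Complex.ofReal_mul, mul_self_sqrt h0, ← hre]
  have hne : ((√(P w w).re : ℝ) : ℂ) ≠ 0 := fun h => hw (by rw [← hsq, h, mul_zero])
  have h1 := hmin u w w v
  rw [ketbra_apply, star_mul', hH.apply]
  simp only [RCLike.star_def, map_inv₀, Complex.conj_ofReal]
  field_simp
  rw [pow_two, hsq]
  exact h1.symm

theorem IsPureState.posSemidef {ι : Type*} [Fintype ι] {P : Matrix ι ι ℂ} (hP : IsPureState P) :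
    P.PosSemidef := by
  obtain ⟨ψ, rfl⟩ := hP.exists_ketbra
  exact posSemidef_ketbra ψ

/-! ### Reduced states of bipartitions, and refinement of partitions -/

section Reduced

variable {n : ℕ} {d : Fin n → ℕ}

/-- The splitting of a configuration into its restrictions to `K` and to the complement of `K`. -/
def cfgEquiv (d : Fin n → ℕ) (K : Finset (Fin n)) :
    SubCfg d K × ((a : {a : Fin n // a ∉ K}) → Fin (d a)) ≃ Cfg d :=
  (Equiv.piEquivPiSubtypeProd (· ∈ K) fun a => Fin (d a)).symm

theorem trace_reduced (K : Finset (Fin n)) (X : Op d) : (reduced K X).trace = X.trace := by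
  unfold trace
  rw [← (cfgEquiv d K).sum_comp, Fintype.sum_prod_type]
  rfl

/-- The coefficients of `ψ` as a matrix, with rows indexed by `K` and columns by the complement. -/
def coeffMatrix (K : Finset (Fin n)) (ψ : Cfg d → ℂ) :
    Matrix (SubCfg d K) ((a : {a : Fin n // a ∉ K}) → Fin (d a)) ℂ :=
  Matrix.of fun u z => ψ (glue u z)

theorem reduced_ketbra (K : Finset (Fin n)) (ψ : Cfg d → ℂ) :
    reduced K (ketbra ψ) = coeffMatrix K ψ * (coeffMatrix K ψ)ᴴ :=
  rfl

theorem posSemidef_reduced {P : Op d} (hP : P.PosSemidef) (K : Finset (Fin n)) :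
    (reduced K P).PosSemidef := by
  have : reduced K P = ∑ z, P.submatrix (fun u => glue u z) (fun u => glue u z) := by
    ext u v
    simp [reduced, Matrix.sum_apply]
  rw [this]
  exact posSemidef_sum _ fun z _ => hP.submatrix _

theorem glue_restrict (K : Finset (Fin n)) (x y : Cfg d) :
    glue (K := K) (fun a => x a) (fun a => y a) = K.piecewise x y := by
  funext a
  by_cases h : a ∈ K <;> simp [glue, h]

/-- The reduced state of `|ψ⟩⟨ψ|` on `K` is pure if and only if `ψ` is a product across the
bipartition of the system into `K` and its complement. -/
theorem vonNeumannEntropy_reduced_ketbra_eq_zero_iff {ψ : Cfg d → ℂ}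
    (hψ : (ketbra ψ).trace = 1) (K : Finset (Fin n)) :
    vonNeumannEntropy (reduced K (ketbra ψ)) = 0 ↔
      ∀ x y : Cfg d, ψ x * ψ y = ψ (K.piecewise x y) * ψ (K.piecewise y x) := by
  have htr : (reduced K (ketbra ψ)).trace = 1 := by rw [trace_reduced, hψ]
  rw [vonNeumannEntropy_eq_zero_iff (posSemidef_reduced (posSemidef_ketbra ψ) K) htr]
  rw [reduced_ketbra] at htr ⊢
  rw [trace_sq_eq_one_iff_minors htr]
  constructor
  · intro h x y
    have := h (fun a => x a) (fun a => y a) (fun a => x a) (fun a => y a)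
    simpa only [coeffMatrix, of_apply, glue_restrict, Finset.piecewise_same] using this
  · intro h u u' z z'
    have := h (glue u z) (glue u' z')
    have hp : ∀ (u u' : SubCfg d K) z z', K.piecewise (glue u z) (glue u' z') = glue u z' :=
      fun u u' z z' => by
        funext a
        by_cases ha : a ∈ K <;> simp [glue, ha]
    rwa [hp, hp] at this

/-- The two reduced states of a bipartite pure state have the same entropy. -/
theorem vonNeumannEntropy_reduced_compl (ψ : Cfg d → ℂ) (K : Finset (Fin n)) :
    vonNeumannEntropy (reduced Kᶜ (ketbra ψ)) = vonNeumannEntropy (reduced K (ketbra ψ)) := by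
  let e : SubCfg d Kᶜ ≃ ((a : {a : Fin n // a ∉ K}) → Fin (d a)) :=
    { toFun := fun u a => u ⟨a, Finset.mem_compl.2 a.2⟩
      invFun := fun z a => z ⟨a, Finset.mem_compl.1 a.2⟩
      left_inv := fun _ => rfl
      right_inv := fun _ => rfl }
  let e' : ((a : {a : Fin n // a ∉ Kᶜ}) → Fin (d a)) ≃ SubCfg d K :=
    { toFun := fun u a => u ⟨a, by simp⟩
      invFun := fun z a => z ⟨a, by simpa using a.2⟩
      left_inv := fun _ => rfl
      right_inv := fun _ => rfl }
  have hglue : ∀ u z, glue (K := Kᶜ) u z = glue (e' z) (e u) := fun u z => by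
    funext a
    by_cases ha : a ∈ K <;> simp [glue, ha, e, e']
  have h : reduced Kᶜ (ketbra ψ) =
      ((coeffMatrix K ψ)ᴴ * coeffMatrix K ψ)ᵀ.submatrix e e := by
    ext u v
    simp only [reduced, of_apply, submatrix_apply, transpose_apply, mul_apply, hglue,
      conjTranspose_apply, coeffMatrix, ketbra_apply]
    rw [← e'.sum_comp]
    exact Finset.sum_congr rfl fun z _ => mul_comm _ _
  have hH := isHermitian_conjTranspose_mul_self (coeffMatrix K ψ)
  rw [h, vonNeumannEntropy_submatrix hH.transpose, vonNeumannEntropy_transpose hH,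
    reduced_ketbra, vonNeumannEntropy_mul_conjTranspose_self]

/-- The configuration of the subsystem `L = K ∪ K'` given by configurations of `K` and `K'`. -/
def merge {K K' L : Finset (Fin n)} (hL : ∀ a, a ∈ L ↔ a ∈ K ∨ a ∈ K') (u : SubCfg d K)
    (w : SubCfg d K') : SubCfg d L :=
  fun a => if h : (a : Fin n) ∈ K then u ⟨a, h⟩ else w ⟨a, ((hL a).1 a.2).resolve_left h⟩

/-- Partial traces compose: the reduced operator on `K` is a partial trace of that on `K ∪ K'`. -/
theorem reduced_eq_sum_merge {K K' L : Finset (Fin n)} (hL : ∀ a, a ∈ L ↔ a ∈ K ∨ a ∈ K')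
    (hdis : Disjoint K K') (X : Op d) (u v : SubCfg d K) :
    reduced K X u v = ∑ w : SubCfg d K', reduced L X (merge hL u w) (merge hL v w) := by
  have hd : ∀ a, a ∈ K' → a ∉ K := fun a h h' => Finset.disjoint_left.1 hdis h' h
  let e : SubCfg d K' × ((a : {a : Fin n // a ∉ L}) → Fin (d a)) ≃
      ((a : {a : Fin n // a ∉ K}) → Fin (d a)) :=
    { toFun := fun p a => if h : (a : Fin n) ∈ K' then p.1 ⟨a, h⟩
        else p.2 ⟨a, fun h' => ((hL a).1 h').elim a.2 h⟩
      invFun := fun z =>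
        (fun a => z ⟨a, hd a a.2⟩, fun a => z ⟨a, fun h => a.2 ((hL a).2 (Or.inl h))⟩)
      left_inv := fun p => by
        ext a
        · simp
        · have : (a : Fin n) ∉ K' := fun h => a.2 ((hL a).2 (Or.inr h))
          simp [this]
      right_inv := fun z => by
        funext a
        by_cases h : (a : Fin n) ∈ K' <;> simp [h] }
  have hglue : ∀ (u : SubCfg d K) w z, glue u (e (w, z)) = glue (merge hL u w) z := fun u w z => by
    funext a
    by_cases ha : a ∈ K
    · simp [glue, merge, ha, (hL a).2 (Or.inl ha)]
    · by_cases ha' : a ∈ K'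
      · simp [glue, merge, ha, ha', (hL a).2 (Or.inr ha'), e]
      · have : a ∉ L := fun h => ((hL a).1 h).elim ha ha'
        simp [glue, ha, ha', this, e]
  simp only [reduced, of_apply]
  rw [← e.sum_comp, Fintype.sum_prod_type]
  simp only [hglue]

theorem vonNeumannEntropy_reduced_union_le {P : Op d} (hP : P.PosSemidef) (htr : P.trace = 1)
    {K K' : Finset (Fin n)} (hdis : Disjoint K K') :
    vonNeumannEntropy (reduced (K ∪ K') P) ≤
      vonNeumannEntropy (reduced K P) + vonNeumannEntropy (reduced K' P) := by
  have hL : ∀ a, a ∈ K ∪ K' ↔ a ∈ K ∨ a ∈ K' := fun a => Finset.mem_union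
  have hL' : ∀ a, a ∈ K ∪ K' ↔ a ∈ K' ∨ a ∈ K := fun a => (hL a).trans or_comm
  have hd : ∀ a, a ∈ K' → a ∉ K := fun a h h' => Finset.disjoint_left.1 hdis h' h
  have hmerge : ∀ (u : SubCfg d K) (w : SubCfg d K'), merge hL' w u = merge hL u w := fun u w => by
    funext a
    by_cases ha : (a : Fin n) ∈ K'
    · simp [merge, ha, hd _ ha]
    · have : (a : Fin n) ∈ K := ((hL a).1 a.2).resolve_right ha
      simp [merge, ha, this]
  let e : SubCfg d K × SubCfg d K' ≃ SubCfg d (K ∪ K') :=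
    { toFun := fun p => merge hL p.1 p.2
      invFun := fun u =>
        (fun a => u ⟨a, (hL a).2 (Or.inl a.2)⟩, fun a => u ⟨a, (hL a).2 (Or.inr a.2)⟩)
      left_inv := fun p => by
        ext a
        · simp [merge]
        · simp [merge, hd a a.2]
      right_inv := fun u => by
        funext a
        by_cases h : (a : Fin n) ∈ K <;> simp [merge, h] }
  have hρ := posSemidef_reduced hP (K ∪ K')
  rw [← vonNeumannEntropy_submatrix hρ.1 e]
  refine vonNeumannEntropy_subadditive (hρ.submatrix e) ?_ (reduced_eq_sum_merge hL hdis P) ?_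
  · rw [← htr, ← trace_reduced (K ∪ K'), trace, trace, ← e.sum_comp]
    rfl
  · intro w w'
    rw [reduced_eq_sum_merge hL' hdis.symm P]
    simp only [hmerge]
    rfl

/-- The entropy of the trivial subsystem vanishes. -/
theorem vonNeumannEntropy_reduced_empty {P : Op d} (hP : P.PosSemidef) (htr : P.trace = 1) :
    vonNeumannEntropy (reduced ∅ P) = 0 := by
  have hρ := posSemidef_reduced hP ∅
  have ht : (reduced ∅ P).trace = 1 := by rw [trace_reduced, htr]
  refine le_antisymm ?_ (vonNeumannEntropy_nonneg hρ ht)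
  refine (vonNeumannEntropy_le_sum_diag hρ).trans (le_of_eq ?_)
  rw [trace, Fintype.sum_unique] at ht
  rw [Fintype.sum_unique]
  rw [diag_apply] at ht
  rw [ht]
  simp

theorem vonNeumannEntropy_reduced_biUnion_le {P : Op d} (hP : P.PosSemidef) (htr : P.trace = 1)
    (s : Finset (Finset (Fin n))) (hs : (s : Set (Finset (Fin n))).PairwiseDisjoint id) :
    vonNeumannEntropy (reduced (s.biUnion id) P) ≤ ∑ K ∈ s, vonNeumannEntropy (reduced K P) := by
  induction s using Finset.induction_on with
  | empty => exact (vonNeumannEntropy_reduced_empty hP htr).le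
  | insert K s hK ih =>
    rw [Finset.biUnion_insert, Finset.sum_insert hK]
    have hdis : Disjoint (id K) (s.biUnion id) := by
      rw [Finset.disjoint_biUnion_right]
      intro K' hK'
      exact hs (Finset.mem_insert_self _ _) (Finset.mem_insert_of_mem hK')
        fun h => hK (h ▸ hK')
    refine (vonNeumannEntropy_reduced_union_le hP htr hdis).trans ?_
    exact add_le_add le_rfl (ih (hs.subset (by simp)))

/-- Coarser partitions have less entanglement entropy. -/
theorem entI_anti {P : Op d} (hP : P.PosSemidef) (htr : P.trace = 1) {α β : LabelI n}
    (h : β ≤ α) : entI α P ≤ entI β P := by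
  have hK : ∀ K ∈ α.parts, vonNeumannEntropy (reduced K P) ≤
      ∑ K' ∈ β.parts with K' ⊆ K, vonNeumannEntropy (reduced K' P) := fun K hK => by
    have hun : K = (β.parts.filter (· ⊆ K)).biUnion id := by
      ext a
      simp only [Finset.mem_biUnion, Finset.mem_filter, id]
      constructor
      · intro ha
        obtain ⟨K', hK', ha'⟩ := β.exists_mem (Finset.mem_univ a)
        obtain ⟨K'', hK'', hsub⟩ := h hK'
        rw [α.eq_of_mem_parts hK hK'' ha (hsub ha')]
        exact ⟨K', ⟨hK', hsub⟩, ha'⟩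
      · rintro ⟨K', ⟨-, hsub⟩, ha⟩
        exact hsub ha
    conv_lhs => rw [hun]
    exact vonNeumannEntropy_reduced_biUnion_le hP htr _
      (β.disjoint.subset (Finset.coe_subset.2 (Finset.filter_subset _ _)))
  refine mul_le_mul_of_nonneg_left ((Finset.sum_le_sum hK).trans (le_of_eq ?_)) (by norm_num)
  rw [Finset.sum_comm' (t' := β.parts) (s' := fun K' => α.parts.filter (K' ⊆ ·))
    (by simp; tauto)]
  refine Finset.sum_congr rfl fun K' hK' => ?_
  obtain ⟨K, hK, hsub⟩ := h hK'
  obtain ⟨a, ha⟩ := β.nonempty_of_mem_parts hK'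
  rw [show α.parts.filter (K' ⊆ ·) = {K} from ?_, Finset.sum_singleton]
  ext K₁
  simp only [Finset.mem_filter, Finset.mem_singleton]
  constructor
  · rintro ⟨h1, h2⟩
    exact α.eq_of_mem_parts h1 hK (h2 ha) (hsub ha)
  · rintro rfl
    exact ⟨hK, hsub⟩

end Reduced

/-! ### Entanglement entropy and separability -/

section Separability

variable {n : ℕ} {d : Fin n → ℕ}

theorem vonNeumannEntropy_reduced_nonneg {P : Op d} (hP : IsPureState P) (K : Finset (Fin n)) :
    0 ≤ vonNeumannEntropy (reduced K P) :=
  vonNeumannEntropy_nonneg (posSemidef_reduced hP.posSemidef K) (by rw [trace_reduced, hP.2.2])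

theorem entI_nonneg {P : Op d} (hP : IsPureState P) (α : LabelI n) : 0 ≤ entI α P :=
  mul_nonneg (by norm_num)
    (Finset.sum_nonneg fun K _ => vonNeumannEntropy_reduced_nonneg hP K)

theorem entI_ketbra_eq_zero_iff {ψ : Cfg d → ℂ} (hψ : (ketbra ψ).trace = 1) (α : LabelI n) :
    entI α (ketbra ψ) = 0 ↔ ∀ K ∈ α.parts, ∀ x y : Cfg d,
      ψ x * ψ y = ψ (K.piecewise x y) * ψ (K.piecewise y x) := by
  rw [entI, mul_eq_zero, or_iff_right (by norm_num), Finset.sum_eq_zero_iff_of_nonneg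
    fun K _ => vonNeumannEntropy_reduced_nonneg (isPureState_ketbra hψ) K]
  exact forall₂_congr fun K _ => vonNeumannEntropy_reduced_ketbra_eq_zero_iff hψ K

/-- A configuration of the whole is a choice of a configuration for each part, so the sum over
configurations of the product over the parts factorizes. -/
theorem trace_tensor (α : LabelI n) (ω : (K : Finset (Fin n)) → SubOp d K) :
    (tensor α ω).trace = ∏ K ∈ α.parts, (ω K).trace := by
  let r : Cfg d → (K : α.parts) → SubCfg d K.1 := fun x K a => x a
  have hr : Function.Bijective r := by
    constructor
    · intro x y h
      funext a
      obtain ⟨K, hK, ha⟩ := α.exists_mem (Finset.mem_univ a)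
      exact congrFun (congrFun h ⟨K, hK⟩) ⟨a, ha⟩
    · intro f
      refine ⟨fun a => f ⟨α.part a, α.part_mem.2 (Finset.mem_univ a)⟩
        ⟨a, α.mem_part (Finset.mem_univ a)⟩, ?_⟩
      funext ⟨K, hK⟩ ⟨a, ha⟩
      obtain rfl := α.part_eq_of_mem hK ha
      rfl
  rw [← Finset.prod_attach]
  simp only [trace, diag_apply]
  rw [Finset.attach_eq_univ, Finset.prod_univ_sum, Fintype.piFinset_univ]
  refine Fintype.sum_bijective r hr _ _ fun x => ?_
  rw [tensor, of_apply, ← Finset.prod_attach, Finset.attach_eq_univ]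

/-- A vector which is a product across every part of `α` is, up to a constant, the product of its
slices through a configuration `y` on which it does not vanish. -/
theorem eq_prod_slices {ψ : Cfg d → ℂ} {α : LabelI n}
    (h : ∀ K ∈ α.parts, ∀ x y : Cfg d, ψ x * ψ y = ψ (K.piecewise x y) * ψ (K.piecewise y x))
    {y : Cfg d} (hy : ψ y ≠ 0) (x : Cfg d) :
    ψ x = ψ y * ∏ K ∈ α.parts, ψ (K.piecewise x y) / ψ y := by
  -- replace `y` by `x` on one part after the other
  have key : ∀ s ⊆ α.parts,
      ψ ((s.biUnion id).piecewise x y) = ψ y * ∏ K ∈ s, ψ (K.piecewise x y) / ψ y := by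
    intro s
    induction s using Finset.induction_on with
    | empty =>
      intro _
      rw [Finset.prod_empty, mul_one]
      exact congrArg ψ (funext fun a => by simp [Finset.piecewise])
    | insert K s hK ih =>
      intro hs
      rw [Finset.prod_insert hK, mul_left_comm, ← ih fun L hL => hs (Finset.mem_insert_of_mem hL),
        div_mul_eq_mul_div, eq_div_iff hy, h K (hs (Finset.mem_insert_self _ _))]
      congr 2
      · funext a
        by_cases ha : a ∈ K <;> simp [Finset.piecewise, ha]
      · funext a
        by_cases ha : a ∈ K
        · have : ∀ L ∈ s, a ∉ L := fun L hL haL => hK <| by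
            rwa [α.eq_of_mem_parts (hs (Finset.mem_insert_self _ _))
              (hs (Finset.mem_insert_of_mem hL)) ha haL]
          simp only [Finset.piecewise, ha, if_true]
          rw [if_neg]
          simpa using this
        · simp [Finset.piecewise, ha]
  -- for all parts at once, the piecewise configuration is `x` itself
  have hun : α.parts.biUnion id = Finset.univ := α.biUnion_parts
  rw [← key α.parts subset_rfl]
  exact congrArg ψ (funext fun a => by simp [Finset.piecewise, hun])

/-- The entropy with respect to `α` detects `α`-separability. -/
theorem entI_eq_zero_iff {P : Op d} (hP : IsPureState P) (α : LabelI n) :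
    entI α P = 0 ↔ P ∈ pureSepI d α := by
  constructor
  · obtain ⟨ψ, rfl⟩ := hP.exists_ketbra
    have htr := hP.2.2
    rw [entI_ketbra_eq_zero_iff htr]
    intro h
    obtain ⟨y, hy⟩ : ∃ y, ψ y ≠ 0 := by
      by_contra! hcon
      rw [trace_ketbra] at htr
      simp [hcon] at htr
    set φ : (K : Finset (Fin n)) → SubCfg d K → ℂ := fun K u => ψ (glue u fun a => y a) / ψ y
      with hφ
    have hprod : ∀ x, ψ x = ψ y * ∏ K ∈ α.parts, φ K fun a => x a := fun x => by
      rw [eq_prod_slices h hy x]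
      simp only [hφ, glue_restrict]
    set N : Finset (Fin n) → ℝ := fun K => ∑ u, Complex.normSq (φ K u) with hN
    have hNpos : ∀ K, 0 < N K := fun K => by
      refine Finset.sum_pos' (fun u _ => Complex.normSq_nonneg _)
        ⟨fun a => y a, Finset.mem_univ _, ?_⟩
      rw [Complex.normSq_pos]
      simp only [hφ, glue_restrict, Finset.piecewise_same]
      exact div_ne_zero hy hy
    set ω : (K : Finset (Fin n)) → SubOp d K := fun K => ((N K : ℂ)⁻¹) • ketbra (φ K) with hω
    have hωk : ∀ K, ω K = ketbra fun u => ((√(N K) : ℝ) : ℂ)⁻¹ * φ K u := fun K => by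
      ext u v
      have : (N K : ℂ) = ((√(N K) : ℝ) : ℂ) * ((√(N K) : ℝ) : ℂ) := by
        rw [← Complex.ofReal_mul, mul_self_sqrt (hNpos K).le]
      simp only [hω, Matrix.smul_apply, ketbra_apply, star_mul', smul_eq_mul, RCLike.star_def,
        map_inv₀, Complex.conj_ofReal]
      rw [this, mul_inv]
      ring
    have hωtr : ∀ K, (ω K).trace = 1 := fun K => by
      rw [hω, trace_smul, trace_ketbra, smul_eq_mul]
      exact inv_mul_cancel₀ (Complex.ofReal_ne_zero.2 (hNpos K).ne')
    have hC : ketbra ψ = (ψ y * star (ψ y) * ∏ K ∈ α.parts, (N K : ℂ)) • tensor α ω := by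
      ext x x'
      have hNne : ∀ K, (N K : ℂ) ≠ 0 := fun K => Complex.ofReal_ne_zero.2 (hNpos K).ne'
      simp only [Matrix.smul_apply, tensor, of_apply, hω, ketbra_apply, smul_eq_mul,
        Finset.prod_mul_distrib, Finset.prod_inv_distrib]
      rw [hprod x, hprod x', star_mul', star_prod]
      have : ∏ K ∈ α.parts, (N K : ℂ) ≠ 0 := Finset.prod_ne_zero_iff.2 fun K _ => hNne K
      field_simp
    -- comparing traces shows that the constant of proportionality is one
    have hC1 : ψ y * star (ψ y) * ∏ K ∈ α.parts, (N K : ℂ) = 1 := by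
      have := congrArg trace hC
      rw [htr, trace_smul, trace_tensor, Finset.prod_congr rfl fun K _ => hωtr K] at this
      simpa using this.symm
    refine ⟨ω, fun K _ => ?_, by rw [hC, hC1, one_smul]⟩
    rw [hωk]
    exact isPureState_ketbra (by rw [← hωk, hωtr])
  · rintro ⟨ω, hω, rfl⟩
    have hex : ∀ K, ∃ φ : SubCfg d K → ℂ, K ∈ α.parts → ω K = ketbra φ := fun K => by
      by_cases hK : K ∈ α.parts
      · obtain ⟨φ, hφ⟩ := (hω K hK).exists_ketbra
        exact ⟨φ, fun _ => hφ⟩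
      · exact ⟨0, fun h => absurd h hK⟩
    choose φ hφ using hex
    have hket : tensor α ω = ketbra fun x => ∏ K ∈ α.parts, φ K fun a => x a := by
      ext x y
      rw [tensor, of_apply, ketbra_apply, star_prod, ← Finset.prod_mul_distrib]
      exact Finset.prod_congr rfl fun K hK => by rw [hφ K hK, ketbra_apply]
    have htr := hP.2.2
    rw [hket] at htr ⊢
    rw [entI_ketbra_eq_zero_iff htr]
    intro L hL x y
    rw [← Finset.prod_mul_distrib, ← Finset.prod_mul_distrib]
    refine Finset.prod_congr rfl fun K hK => ?_
    by_cases hKL : K = L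
    · subst hKL
      simp
    · have : ∀ a : {a // a ∈ K}, (a : Fin n) ∉ L := fun a haL =>
        hKL (α.eq_of_mem_parts hK hL a.2 haL)
      simp only [Finset.piecewise, this, if_false]
      rw [mul_comm]

theorem entII_eq_zero_iff {P : Op d} (hP : IsPureState P) (A : LabelII n) :
    entII A P = 0 ↔ P ∈ pureSepII d A := by
  obtain ⟨⟨α, hα, hmin⟩, hle⟩ := entII_isLeast A P
  simp only [pureSepII, Set.mem_iUnion, ← entI_eq_zero_iff hP]
  constructor
  · intro h
    exact ⟨α, hα, hmin.trans h⟩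
  · rintro ⟨β, hβ, h0⟩
    refine le_antisymm (h0 ▸ hle ⟨β, hβ, rfl⟩) ?_
    rw [← hmin]
    exact entI_nonneg hP α

/-! ### Products of GHZ states distinguish the partitions -/

/-- The configurations with values in `{0, 1}` which are constant on each part of `β`: the support
of the product of the GHZ vectors of the parts. -/
def IsPartwiseConstant (β : LabelI n) (x : Cfg d) : Prop :=
  (∀ a, (x a : ℕ) ≤ 1) ∧ ∀ K ∈ β.parts, ∀ a ∈ K, ∀ b ∈ K, (x a : ℕ) = x b

theorem IsPartwiseConstant.piecewise {β : LabelI n} {x y : Cfg d} (hx : IsPartwiseConstant β x)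
    (hy : IsPartwiseConstant β y) {K : Finset (Fin n)} (hK : K ∈ β.parts) :
    IsPartwiseConstant β (K.piecewise x y) := by
  constructor
  · intro a
    by_cases ha : a ∈ K
    · simpa [ha] using hx.1 a
    · simpa [ha] using hy.1 a
  · intro L hL a ha b hb
    by_cases hLK : L = K
    · subst hLK
      simpa [ha, hb] using hx.2 L hL a ha b hb
    · have h : ∀ c ∈ L, c ∉ K := fun c hc hcK => hLK (β.eq_of_mem_parts hL hK hc hcK)
      simpa [h a ha, h b hb] using hy.2 L hL a ha b hb

/-- A product of GHZ states over the parts of `β` is `α`-separable exactly for the `α` coarser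
than or equal to `β`. -/
theorem exists_isPureState_entI_eq_zero_iff (hd : ∀ a, 1 < d a) (β : LabelI n) :
    ∃ P : Op d, IsPureState P ∧ ∀ α : LabelI n, entI α P = 0 ↔ β ≤ α := by
  classical
  set c0 : Cfg d := fun a => ⟨0, zero_lt_one.trans (hd a)⟩ with hc0
  set c1 : Cfg d := fun a => ⟨1, hd a⟩ with hc1
  have h0 : IsPartwiseConstant β c0 := ⟨fun a => by simp [c0], fun K _ a _ b _ => rfl⟩
  have h1 : IsPartwiseConstant β c1 := ⟨fun a => by simp [c1], fun K _ a _ b _ => rfl⟩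
  set N : ℝ := ∑ x : Cfg d, if IsPartwiseConstant β x then 1 else 0 with hN
  have hNpos : 0 < N := Finset.sum_pos' (fun x _ => by split_ifs <;> norm_num)
    ⟨c0, Finset.mem_univ _, by simp [h0]⟩
  set r : ℂ := ((√N : ℝ) : ℂ)⁻¹ with hr
  have hrne : r ≠ 0 := inv_ne_zero (Complex.ofReal_ne_zero.2 (sqrt_pos.2 hNpos).ne')
  set ψ : Cfg d → ℂ := fun x => if IsPartwiseConstant β x then r else 0 with hψ
  have htr : (ketbra ψ).trace = 1 := by
    have : ∀ x, Complex.normSq (ψ x) = N⁻¹ * if IsPartwiseConstant β x then 1 else 0 := fun x => by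
      by_cases hx : IsPartwiseConstant β x
      · simp [hψ, hx, hr, mul_self_sqrt hNpos.le]
      · simp [hψ, hx]
    rw [trace_ketbra]
    simp_rw [this]
    rw [← Finset.mul_sum, inv_mul_cancel₀ hNpos.ne', Complex.ofReal_one]
  have hpure := isPureState_ketbra htr
  have hββ : entI β (ketbra ψ) = 0 := by
    rw [entI_ketbra_eq_zero_iff htr]
    intro K hK x y
    have hiff : (IsPartwiseConstant β x ∧ IsPartwiseConstant β y) ↔
        (IsPartwiseConstant β (K.piecewise x y) ∧ IsPartwiseConstant β (K.piecewise y x)) := by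
      constructor
      · rintro ⟨hx, hy⟩
        exact ⟨hx.piecewise hy hK, hy.piecewise hx hK⟩
      -- mixing twice restores `x` and `y`
      · rintro ⟨hx, hy⟩
        exact ⟨by simpa [Finset.piecewise_same] using hx.piecewise hy hK,
          by simpa [Finset.piecewise_same] using hy.piecewise hx hK⟩
    have hmul : ∀ x y, ψ x * ψ y =
        if IsPartwiseConstant β x ∧ IsPartwiseConstant β y then r * r else 0 := fun x y => by
      simp only [hψ, ite_and]
      split_ifs <;> simp
    rw [hmul, hmul]
    simp only [hiff]
  refine ⟨ketbra ψ, hpure, fun α => ⟨fun h K hK => ?_, fun h => ?_⟩⟩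
  · rw [entI_ketbra_eq_zero_iff htr] at h
    obtain ⟨a, ha⟩ := β.nonempty_of_mem_parts hK
    obtain ⟨L, hL, haL⟩ := α.exists_mem (Finset.mem_univ a)
    refine ⟨L, hL, fun b hb => ?_⟩
    by_contra hbL
    have hmix : ¬ IsPartwiseConstant β (L.piecewise c0 c1) := fun hg => by
      simpa [haL, hbL, c0, c1] using hg.2 K hK a ha b hb
    -- all zeros and all ones lie in the support, but mixing them across `L` splits the part `K`
    have := h L hL c0 c1
    simp [hψ, h0, h1, hmix, hrne] at this
  · exact le_antisymm (hββ ▸ entI_anti hpure.posSemidef htr h) (entI_nonneg hpure α)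

theorem le_iff_forall_entII_le (hd : ∀ a, 1 < d a) (A B : LabelII n) :
    B ≤ A ↔ ∀ P : Op d, IsPureState P → entII A P ≤ entII B P := by
  constructor
  · intro h P _
    obtain ⟨⟨β, hβ, hmin⟩, -⟩ := entII_isLeast B P
    rw [← hmin]
    exact (entII_isLeast A P).2 ⟨β, h hβ, rfl⟩
  · intro h β hβ
    obtain ⟨P, hP, hsep⟩ := exists_isPureState_entI_eq_zero_iff hd β
    obtain ⟨⟨α, hα, hmin⟩, -⟩ := entII_isLeast A P
    have hB : entII B P ≤ 0 :=
      (hsep β).2 le_rfl ▸ (entII_isLeast B P).2 ⟨β, hβ, rfl⟩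
    have h0 : entI α P = 0 := le_antisymm (hmin.trans_le ((h P hP).trans hB)) (entI_nonneg hP α)
    exact A.1.lower ((hsep α).1 h0) hα

theorem le_iff_forall_entI_le (hd : ∀ a, 1 < d a) (α β : LabelI n) :
    β ≤ α ↔ ∀ P : Op d, IsPureState P → entI α P ≤ entI β P := by
  refine ⟨fun h P hP => entI_anti hP.posSemidef hP.2.2 h, fun h => ?_⟩
  obtain ⟨P, hP, hsep⟩ := exists_isPureState_entI_eq_zero_iff hd β
  exact (hsep α).1 (le_antisymm ((h P hP).trans_eq ((hsep β).2 le_rfl)) (entI_nonneg hP α))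

end Separability

/-! ### The reduced state of the unmeasured parties -/

section LOCC

variable {n : ℕ} {d c e : Fin n → ℕ}

/-- For `a ∉ K`, a configuration of the complement of `K` consists of the value at `a` and of values
at the other subsystems, whose dimensions are the same for `c` and `d`. -/
def complSplit {a : Fin n} (hc : ∀ b, b ≠ a → c b = d b) {K : Finset (Fin n)} (ha : a ∉ K) :
    Fin (c a) × ((b : {b : Fin n // b ∉ K ∧ b ≠ a}) → Fin (d b)) ≃
      ((b : {b : Fin n // b ∉ K}) → Fin (c b)) where
  toFun p b := if h : (b : Fin n) = a then Fin.cast (congrArg c h.symm) p.1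
    else Fin.cast (hc b h).symm (p.2 ⟨b, b.2, h⟩)
  invFun z := (z ⟨a, ha⟩, fun b => Fin.cast (hc b b.2.2) (z ⟨b, b.2.1⟩))
  left_inv p := by
    ext b
    · simp
    · simp [b.2.2]
  right_inv z := by
    funext ⟨b, hb⟩
    by_cases h : b = a
    · subst h; simp
    · simp [h]

/-- The configurations of `K ∌ a` are the same for `c` and `d`. -/
def subCfgCast {a : Fin n} (hc : ∀ b, b ≠ a → c b = d b) {K : Finset (Fin n)} (ha : a ∉ K) :
    SubCfg d K ≃ SubCfg c K :=
  Equiv.piCongrRight fun b => finCongr (hc b fun h => ha (h ▸ b.2)).symm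

/-- In the row of a configuration, `M ⊗ 1` has nonzero entries only in the columns which differ from
it at `a` alone. -/
theorem sum_localOp_mul {a : Fin n} (hc : ∀ b, b ≠ a → c b = d b)
    (M : Matrix (Fin (c a)) (Fin (d a)) ℂ) {K : Finset (Fin n)} (ha : a ∉ K) (u : SubCfg d K)
    (s : Fin (c a)) (r : (b : {b : Fin n // b ∉ K ∧ b ≠ a}) → Fin (d b)) (g : Cfg d → ℂ) :
    ∑ x, localOp a M (glue (subCfgCast hc ha u) (complSplit hc ha (s, r))) x * g x =
      ∑ t, M s t * g (glue u (complSplit (fun _ _ => rfl) ha (t, r))) := by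
  symm
  have hval : ∀ (t : Fin (d a)), glue u (complSplit (fun _ _ => rfl) ha (t, r)) a = t := fun t => by
    simp [glue, ha, complSplit]
  have hval' : glue (subCfgCast hc ha u) (complSplit hc ha (s, r)) a = s := by
    simp [glue, ha, complSplit]
  have hother : ∀ t b, b ≠ a → (glue (subCfgCast hc ha u) (complSplit hc ha (s, r)) b : ℕ) =
      glue u (complSplit (fun _ _ => rfl) ha (t, r)) b := fun t b hb => by
    by_cases hbK : b ∈ K
    · simp [glue, hbK, subCfgCast]
    · simp [glue, hbK, complSplit, hb]
  refine Fintype.sum_of_injective (fun t => glue u (complSplit (fun _ _ => rfl) ha (t, r)))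
    ?_ _ _ ?_ ?_
  · intro t t' h
    rw [← hval t, ← hval t']
    exact congrFun h a
  · intro x hx
    rw [localOp, of_apply, if_neg, zero_mul]
    intro hagree
    refine hx ⟨x a, ?_⟩
    funext b
    by_cases hb : b = a
    · subst hb
      exact hval _
    · exact Fin.ext ((hother (x a) b hb).symm.trans (hagree b hb))
  · intro t
    rw [localOp, of_apply, if_pos (hother t), hval', hval]

theorem mul_mul_conjTranspose_apply {ι κ : Type*} [Fintype ι] (L : Matrix κ ι ℂ)
    (X : Matrix ι ι ℂ) (x y : κ) :
    (L * X * Lᴴ) x y = ∑ x', L x x' * ∑ y', X x' y' * star (L y y') := by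
  rw [Matrix.mul_assoc, mul_apply]
  rfl

/-- A local measurement does not change, on average, the reduced state of the other parties. -/
theorem sum_reduced_localOp {a : Fin n} {m : ℕ} {c : Fin m → Fin n → ℕ}
    (hc : ∀ i b, b ≠ a → c i b = d b) {M : (i : Fin m) → Matrix (Fin (c i a)) (Fin (d a)) ℂ}
    (hM : ∑ i, (M i)ᴴ * M i = 1) (X : Op d) {K : Finset (Fin n)} (ha : a ∉ K) :
    ∑ i, (reduced K (localOp a (M i) * X * (localOp a (M i))ᴴ)).submatrix
      (subCfgCast (hc i) ha) (subCfgCast (hc i) ha) = reduced K X := by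
  ext u v
  have hMe : ∀ t t', ∑ i, ∑ s, M i s t * star (M i s t') = if t' = t then 1 else 0 :=
    fun t t' => by
      have := congrFun (congrFun hM t') t
      rw [Matrix.sum_apply] at this
      rw [← one_apply, ← this]
      refine Finset.sum_congr rfl fun i _ => ?_
      rw [mul_apply]
      exact Finset.sum_congr rfl fun s _ => mul_comm _ _
  have hentry : ∀ i s r, (localOp a (M i) * X * (localOp a (M i))ᴴ)
      (glue (subCfgCast (hc i) ha u) (complSplit (hc i) ha (s, r)))
      (glue (subCfgCast (hc i) ha v) (complSplit (hc i) ha (s, r))) =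
      ∑ t, ∑ t', M i s t * star (M i s t') *
        X (glue u (complSplit (fun _ _ => rfl) ha (t, r)))
          (glue v (complSplit (fun _ _ => rfl) ha (t', r))) := fun i s r => by
    refine (mul_mul_conjTranspose_apply _ _ _ _).trans ?_
    rw [sum_localOp_mul]
    refine Finset.sum_congr rfl fun t _ => ?_
    have h2 := congrArg star (sum_localOp_mul (hc i) (M i) ha v s r fun y =>
      star (X (glue u (complSplit (fun _ _ => rfl) ha (t, r))) y))
    simp only [star_sum, star_mul', star_star] at h2
    rw [Finset.sum_congr rfl fun y _ => mul_comm (X _ y) _, h2, Finset.mul_sum]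
    exact Finset.sum_congr rfl fun t' _ => (mul_assoc _ _ _).symm
  rw [Matrix.sum_apply]
  simp only [submatrix_apply, reduced, of_apply]
  rw [← (complSplit (d := d) (c := d) (fun _ _ => rfl) ha).sum_comp, Fintype.sum_prod_type_right]
  have hi : ∀ i, ∑ z, (localOp a (M i) * X * (localOp a (M i))ᴴ)
      (glue (subCfgCast (hc i) ha u) z) (glue (subCfgCast (hc i) ha v) z) =
      ∑ r, ∑ t, ∑ t', (∑ s, M i s t * star (M i s t')) *
        X (glue u (complSplit (fun _ _ => rfl) ha (t, r)))
          (glue v (complSplit (fun _ _ => rfl) ha (t', r))) := fun i => by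
    rw [← (complSplit (hc i) ha).sum_comp, Fintype.sum_prod_type_right]
    refine Finset.sum_congr rfl fun r _ => ?_
    simp only [hentry]
    rw [Finset.sum_comm]
    refine Finset.sum_congr rfl fun t _ => ?_
    rw [Finset.sum_comm]
    simp only [Finset.sum_mul]
  simp only [hi]
  rw [Finset.sum_comm]
  refine Finset.sum_congr rfl fun r _ => ?_
  rw [Finset.sum_comm]
  refine Finset.sum_congr rfl fun t _ => ?_
  rw [Finset.sum_comm]
  simp only [← Finset.sum_mul, hMe]
  simp

/-! ### Monotonicity under LOCC -/

theorem mul_ketbra_mul_conjTranspose {ι κ : Type*} [Fintype ι] (B : Matrix κ ι ℂ)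
    (ψ : ι → ℂ) : B * ketbra ψ * Bᴴ = ketbra (B *ᵥ ψ) := by
  rw [ketbra, mul_vecMulVec, vecMulVec_mul, ketbra, star_mulVec]

theorem ofReal_outcomeProb {P : Op d} (hP : P.PosSemidef) (B : Matrix (Cfg e) (Cfg d) ℂ) :
    (outcomeProb B P : ℂ) = (B * P * Bᴴ).trace :=
  Complex.ext rfl (Complex.nonneg_iff.1 (hP.mul_mul_conjTranspose_same B).trace_nonneg).2

theorem outcomeProb_nonneg {P : Op d} (hP : P.PosSemidef) (B : Matrix (Cfg e) (Cfg d) ℂ) :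
    0 ≤ outcomeProb B P :=
  (Complex.nonneg_iff.1 (hP.mul_mul_conjTranspose_same B).trace_nonneg).1

/-- If the outcome has probability zero, both sides vanish. -/
theorem outcomeProb_smul_outcomeState {P : Op d} (hP : P.PosSemidef)
    (B : Matrix (Cfg e) (Cfg d) ℂ) :
    (outcomeProb B P : ℂ) • outcomeState B P = B * P * Bᴴ := by
  by_cases h : outcomeProb B P = 0
  · have h0 : (B * P * Bᴴ).trace = 0 := by rw [← ofReal_outcomeProb hP, h, Complex.ofReal_zero]
    rw [(hP.mul_mul_conjTranspose_same B).trace_eq_zero_iff.1 h0, h, Complex.ofReal_zero, zero_smul]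
  · rw [outcomeState, smul_smul, mul_inv_cancel₀ (Complex.ofReal_ne_zero.2 h), one_smul]

theorem posSemidef_outcomeState {P : Op d} (hP : P.PosSemidef) (B : Matrix (Cfg e) (Cfg d) ℂ) :
    (outcomeState B P).PosSemidef := by
  refine (hP.mul_mul_conjTranspose_same B).smul ?_
  rw [← Complex.ofReal_inv]
  exact_mod_cast inv_nonneg.2 (outcomeProb_nonneg hP B)

theorem IsPureState.outcomeState {P : Op d} (hP : IsPureState P) {B : Matrix (Cfg e) (Cfg d) ℂ}
    (h : outcomeProb B P ≠ 0) : IsPureState (outcomeState B P) := by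
  have htr : (MultipartiteEntanglement.outcomeState B P).trace = 1 := by
    rw [MultipartiteEntanglement.outcomeState, trace_smul, ← ofReal_outcomeProb hP.posSemidef,
      smul_eq_mul, inv_mul_cancel₀ (Complex.ofReal_ne_zero.2 h)]
  obtain ⟨ψ, rfl⟩ := hP.exists_ketbra
  have hket : MultipartiteEntanglement.outcomeState B (ketbra ψ) =
      ketbra (((√(outcomeProb B (ketbra ψ)) : ℝ) : ℂ)⁻¹ • (B *ᵥ ψ)) := by
    have hsq : (outcomeProb B (ketbra ψ) : ℂ) = ((√(outcomeProb B (ketbra ψ)) : ℝ) : ℂ) *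
        ((√(outcomeProb B (ketbra ψ)) : ℝ) : ℂ) := by
      rw [← Complex.ofReal_mul, mul_self_sqrt (outcomeProb_nonneg (posSemidef_ketbra ψ) B)]
    rw [MultipartiteEntanglement.outcomeState, mul_ketbra_mul_conjTranspose, hsq]
    ext x y
    simp only [Matrix.smul_apply, ketbra_apply, Pi.smul_apply, smul_eq_mul, star_mul',
      RCLike.star_def, map_inv₀, Complex.conj_ofReal]
    rw [mul_inv]
    ring
  rw [hket] at htr ⊢
  exact isPureState_ketbra htr

/-- For a part `K`, the party `a` may be taken outside of `K`, because a bipartite pure state has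
two reduced states of equal entropy. Then the reduced state on `K` is unchanged on average, and the
claim is concavity of the entropy. -/
theorem sum_outcomeProb_mul_entropy_le {a : Fin n} {m : ℕ} {c : Fin m → Fin n → ℕ}
    (hc : ∀ i b, b ≠ a → c i b = d b) {M : (i : Fin m) → Matrix (Fin (c i a)) (Fin (d a)) ℂ}
    (hM : ∑ i, (M i)ᴴ * M i = 1) {P : Op d} (hP : IsPureState P) (K : Finset (Fin n)) :
    ∑ i, outcomeProb (localOp a (M i)) P *
      vonNeumannEntropy (reduced K (outcomeState (localOp a (M i)) P)) ≤
      vonNeumannEntropy (reduced K P) := by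
  have main : ∀ K : Finset (Fin n), a ∉ K → ∑ i, outcomeProb (localOp a (M i)) P *
      vonNeumannEntropy (reduced K (outcomeState (localOp a (M i)) P)) ≤
      vonNeumannEntropy (reduced K P) := by
    intro K ha
    set p : Fin m → ℝ := fun i => outcomeProb (localOp a (M i)) P with hp
    set σ : (i : Fin m) → Op (c i) := fun i => outcomeState (localOp a (M i)) P with hσ
    have hσp : ∀ i, (reduced K (σ i)).PosSemidef := fun i =>
      posSemidef_reduced (posSemidef_outcomeState hP.posSemidef _) K
    have hsmul : ∀ i, (p i : ℂ) • reduced K (σ i) =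
        reduced K (localOp a (M i) * P * (localOp a (M i))ᴴ) := fun i => by
      rw [← outcomeProb_smul_outcomeState hP.posSemidef]
      ext u v
      simp [reduced, Finset.mul_sum, hp, hσ]
    have hsum : ∑ i, (p i : ℂ) • (reduced K (σ i)).submatrix (subCfgCast (hc i) ha)
        (subCfgCast (hc i) ha) = reduced K P := by
      rw [← sum_reduced_localOp hc hM P ha]
      exact Finset.sum_congr rfl fun i _ => by rw [← hsmul]; rfl
    have hp1 : ∑ i, p i = 1 := by
      have h := congrArg trace (sum_reduced_localOp hc hM P ha)
      rw [trace_sum, trace_reduced, hP.2.2] at h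
      apply Complex.ofReal_injective
      rw [Complex.ofReal_sum, Complex.ofReal_one, ← h]
      refine Finset.sum_congr rfl fun i _ => ?_
      rw [hp, ofReal_outcomeProb hP.posSemidef, ← trace_reduced K, trace, trace,
        ← (subCfgCast (hc i) ha).sum_comp]
      rfl
    rw [← hsum]
    refine le_trans (le_of_eq ?_) (sum_mul_vonNeumannEntropy_le p
      (fun i => outcomeProb_nonneg hP.posSemidef _) hp1 _ fun i => (hσp i).submatrix _)
    exact Finset.sum_congr rfl fun i _ => by rw [vonNeumannEntropy_submatrix (hσp i).1]
  by_cases ha : a ∈ K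
  · have hcompl : ∀ (d : Fin n → ℕ) (Q : Op d), IsPureState Q →
        vonNeumannEntropy (reduced K Q) = vonNeumannEntropy (reduced Kᶜ Q) := fun d Q hQ => by
      obtain ⟨ψ, rfl⟩ := hQ.exists_ketbra
      exact (vonNeumannEntropy_reduced_compl ψ K).symm
    rw [hcompl d P hP]
    refine le_trans (le_of_eq (Finset.sum_congr rfl fun i _ => ?_))
      (main Kᶜ fun h => Finset.mem_compl.1 h ha)
    by_cases hp : outcomeProb (localOp a (M i)) P = 0
    · rw [hp, zero_mul, zero_mul]
    · rw [hcompl _ _ (hP.outcomeState hp)]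
  · exact main K ha

theorem sum_outcomeProb_mul_entI_le {a : Fin n} {m : ℕ} {c : Fin m → Fin n → ℕ}
    (hc : ∀ i b, b ≠ a → c i b = d b) {M : (i : Fin m) → Matrix (Fin (c i a)) (Fin (d a)) ℂ}
    (hM : ∑ i, (M i)ᴴ * M i = 1) {P : Op d} (hP : IsPureState P) (α : LabelI n) :
    ∑ i, outcomeProb (localOp a (M i)) P * entI α (outcomeState (localOp a (M i)) P) ≤
      entI α P := by
  calc ∑ i, outcomeProb (localOp a (M i)) P * entI α (outcomeState (localOp a (M i)) P)
      = 1 / 2 * ∑ K ∈ α.parts, ∑ i, outcomeProb (localOp a (M i)) P *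
          vonNeumannEntropy (reduced K (outcomeState (localOp a (M i)) P)) := by
        rw [Finset.sum_comm, Finset.mul_sum]
        refine Finset.sum_congr rfl fun i _ => ?_
        rw [entI, ← Finset.mul_sum]
        ring
    _ ≤ entI α P := mul_le_mul_of_nonneg_left
        (Finset.sum_le_sum fun K _ => sum_outcomeProb_mul_entropy_le hc hM hP K) (by norm_num)

/-- The partition which is optimal for the initial state is one candidate for each outcome. -/
theorem sum_outcomeProb_mul_entII_le {a : Fin n} {m : ℕ} {c : Fin m → Fin n → ℕ}
    (hc : ∀ i b, b ≠ a → c i b = d b) {M : (i : Fin m) → Matrix (Fin (c i a)) (Fin (d a)) ℂ}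
    (hM : ∑ i, (M i)ᴴ * M i = 1) {P : Op d} (hP : IsPureState P) (A : LabelII n) :
    ∑ i, outcomeProb (localOp a (M i)) P * entII A (outcomeState (localOp a (M i)) P) ≤
      entII A P := by
  obtain ⟨⟨α, hα, hmin⟩, -⟩ := entII_isLeast A P
  rw [← hmin]
  refine le_trans (Finset.sum_le_sum fun i _ => mul_le_mul_of_nonneg_left ?_
    (outcomeProb_nonneg hP.posSemidef _)) (sum_outcomeProb_mul_entI_le hc hM hP α)
  exact (entII_isLeast A _).2 ⟨α, hα, rfl⟩

theorem comp_mul_mul_conjTranspose {P : Op d} (hP : P.PosSemidef) (L : Matrix (Cfg c) (Cfg d) ℂ)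
    (B : Matrix (Cfg e) (Cfg c) ℂ) :
    B * L * P * (B * L)ᴴ = (outcomeProb L P : ℂ) • (B * outcomeState L P * Bᴴ) := by
  rw [conjTranspose_mul, ← Matrix.smul_mul, ← Matrix.mul_smul, outcomeProb_smul_outcomeState hP]
  simp only [Matrix.mul_assoc]

theorem outcomeProb_mul {P : Op d} (hP : P.PosSemidef) (L : Matrix (Cfg c) (Cfg d) ℂ)
    (B : Matrix (Cfg e) (Cfg c) ℂ) :
    outcomeProb (B * L) P = outcomeProb L P * outcomeProb B (outcomeState L P) := by
  rw [outcomeProb, comp_mul_mul_conjTranspose hP, trace_smul, smul_eq_mul, Complex.re_ofReal_mul]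
  rfl

theorem outcomeState_mul {P : Op d} (hP : P.PosSemidef) {L : Matrix (Cfg c) (Cfg d) ℂ}
    (hL : outcomeProb L P ≠ 0) (B : Matrix (Cfg e) (Cfg c) ℂ) :
    outcomeState (B * L) P = outcomeState B (outcomeState L P) := by
  rw [outcomeState, comp_mul_mul_conjTranspose hP, outcomeProb_mul hP, smul_smul, outcomeState]
  congr 1
  have : (outcomeProb L P : ℂ) ≠ 0 := Complex.ofReal_ne_zero.2 hL
  push_cast
  rw [mul_inv]
  field_simp

/-- A function which is nonincreasing on average in every round is nonincreasing on average under
every protocol. -/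
theorem isPureEntanglementMonotone_of_round {f : (d : Fin n → ℕ) → Op d → ℝ}
    (hf : ∀ (d : Fin n → ℕ) (a : Fin n) (m : ℕ) (c : Fin m → Fin n → ℕ)
      (_ : ∀ i b, b ≠ a → c i b = d b) (M : (i : Fin m) → Matrix (Fin (c i a)) (Fin (d a)) ℂ)
      (_ : ∑ i, (M i)ᴴ * M i = 1) (P : Op d) (_ : IsPureState P),
      ∑ i, outcomeProb (localOp a (M i)) P * f (c i) (outcomeState (localOp a (M i)) P) ≤ f d P) :
    IsPureEntanglementMonotone f := by
  intro d e Λ hΛ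
  induction hΛ with
  | done =>
    intro P hP
    have h1 : outcomeProb (1 : Op e) P = 1 := by simp [outcomeProb, hP.2.2]
    simp [outcomeState, h1]
  | @round d a m c hc M hM rest hrest ih =>
    intro P hP
    rw [List.map_flatten, List.map_ofFn, List.sum_flatten, List.map_ofFn, List.sum_ofFn]
    refine le_trans (Finset.sum_le_sum fun i _ => ?_) (hf d a m c hc M hM P hP)
    simp only [Function.comp_apply, List.map_map]
    by_cases hp : outcomeProb (localOp a (M i)) P = 0
    · simp [Function.comp_def, outcomeProb_mul hP.posSemidef, hp]
    · refine le_trans (le_of_eq ?_) (mul_le_mul_of_nonneg_left (ih i _ (hP.outcomeState hp))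
        (outcomeProb_nonneg hP.posSemidef _))
      rw [← List.sum_map_mul_left]
      simp only [Function.comp_def, outcomeProb_mul hP.posSemidef,
        outcomeState_mul hP.posSemidef hp, mul_assoc]

end LOCC

end MultipartiteEntanglement

open MultipartiteEntanglement
theorem mainTheorem8 (n : ℕ) (hn : 0 < n) :
    (∀ A : LabelII n, IsPureEntanglementMonotone (fun (d : Fin n → ℕ) (P : Op d) => entII A P)) ∧
    ∀ d : Fin n → ℕ, (∀ a, 1 < d a) →
      (∀ (A : LabelII n) (P : Op d), IsPureState P → (entII A P = 0 ↔ P ∈ pureSepII d A)) ∧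
      (∀ A B : LabelII n, B ≤ A ↔ ∀ P : Op d, IsPureState P → entII A P ≤ entII B P) ∧
      (∀ α β : LabelI n, β ≤ α ↔ ∀ P : Op d, IsPureState P → entI α P ≤ entI β P) := by
  refine ⟨fun A => isPureEntanglementMonotone_of_round fun d a m c hc M hM P hP =>
    sum_outcomeProb_mul_entII_le hc hM hP A, fun d hd => ⟨fun A P hP => entII_eq_zero_iff hP A,
    le_iff_forall_entII_le hd, le_iff_forall_entI_le hd⟩⟩
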